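/- Let $k$ be a field (small, i.e. an element of a fixed universe, as are all sets, profinite sets and algebras below). All $k$-algebras are commutative and unital. Let $\mathrm{ProFin}$ be the category of profinite sets and $\mathrm{CAlg}_k$ the category of $k$-algebras. For a profinite set $S$, let $\mathcal C(S,k)$ be the $k$-algebra of continuous functions from $S$ to $k$ with its discrete topology. Let $\mathrm{CAlg}_k^{\mathrm{Stone}}\subseteq \mathrm{CAlg}_k$ be the full subcategory of Stone $k$-algebras, i.e. the closure under filtered colimits of the algebras $k^S$ with $S$ a finite set. A presheaf of sets $\mathcal C^{\mathrm{op}}\to\mathrm{Set}$ is called accessible if it preserves $\kappa$-filtered colimits for some regular cardinal $\kappa$. Let $\mathrm{Cond}$ be the category of condensed sets, that is, of accessible sheaves of sets on $\mathrm{ProFin}$ for the effective epimorphism topology, whose covering sieves are those containing a finite jointly surjective family. Let $\mathrm{Shv}^{\mathrm{fpqc}}_k$ be the category of accessible sheaves of sets on $\mathrm{CAlg}_k^{\mathrm{op}}$ for the fpqc topology, which is generated by the finite families $(\mathrm{Spec}\,B_i\to\mathrm{Spec}\,A)_i$ with all $A\to B_i$ flat and $\coprod_i|\mathrm{Spec}\,B_i|\to|\mathrm{Spec}\,A|$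 surjective. Morphisms in both categories are all morphisms of presheaves. Then the functor $S\mapsto \mathcal C(S,k)$ induces an equivalence of categories $\mathrm{ProFin}\simeq(\mathrm{CAlg}_k^{\mathrm{Stone}})^{\mathrm{op}}$ (Stone duality), and its composite with the inclusion $(\mathrm{CAlg}_k^{\mathrm{Stone}})^{\mathrm{op}}\subseteq\mathrm{CAlg}_k^{\mathrm{op}}$ induces an adjunction $$f^*:\mathrm{Cond}\rightleftarrows\mathrm{Shv}^{\mathrm{fpqc}}_k:f_*$$ in which the right adjoint $f_*$ is restriction along this composite, i.e. it sends an fpqc sheaf $\mathcal X$, naturally in $\mathcal X$, to the condensed set $S\mapsto\mathcal X(\mathcal C(S,k))$. The left adjoint $f^*$ is fully faithful and preserves all colimits and all finite limits. -/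

import Mathlib

open CategoryTheory Limits Opposite

universe w w' u

namespace Petra

/-! ### Accessible sheaves on a (not necessarily small) site -/

/-- For a Grothendieck topology `J` on a large category `C`, the category of those sheaves of
(small) sets on `(C, J)` whose underlying presheaf `Cᵒᵖ ⥤ Type u` is accessible, i.e. preserves
small `κ`-filtered colimits for some small regular cardinal `κ`. It is a full subcategory of the
category of all sheaves. -/
abbrev AccSheaf {C : Type (u + 1)} [Category.{u} C] (J : GrothendieckTopology C) :=
  ObjectProperty.FullSubcategory
    (fun F : Sheaf J (Type u) => Functor.IsAccessible.{u} F.obj)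

/-- The underlying presheaf of an accessible sheaf. -/
abbrev AccSheaf.toPresheaf {C : Type (u + 1)} [Category.{u} C] (J : GrothendieckTopology C) :
    AccSheaf J ⥤ (Cᵒᵖ ⥤ Type u) :=
  ObjectProperty.ι _ ⋙ sheafToPresheaf J (Type u)

/-! ### Condensed sets -/

/-- The category of condensed sets: accessible sheaves of sets on the category of profinite sets
with the effective epimorphism topology. Covering sieves are those containing a finite jointly
surjective family; this is the coherent topology of `Profinite`. -/
abbrev Cond := AccSheaf (coherentTopology Profinite.{u})

/-! ### fpqc sheaves -/

section Fpqc

variable (k : Type u) [CommRing k]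

/-- The fpqc covering families in the category `CAlg_kᵒᵖ` of affine `k`-schemes: finite families
`Spec B i ⟶ Spec A` such that every `A → B i` is flat and `Spec A` is the union of the images of
the maps `Spec B i → Spec A`. (The empty family is allowed; it covers only `Spec 0`.) -/
def fpqcPrecoverage : Precoverage (CommAlgCat.{u} k)ᵒᵖ where
  coverings X :=
    {R | ∃ (n : ℕ) (B : Fin n → CommAlgCat.{u} k) (f : ∀ i, X.unop ⟶ B i),
      (∀ i, (f i).hom.toRingHom.Flat) ∧
      (∀ p : PrimeSpectrum X.unop, ∃ (i : Fin n) (q : PrimeSpectrum (B i)),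
        PrimeSpectrum.comap (f i).hom.toRingHom q = p) ∧
      R = Presieve.ofArrows (fun i => op (B i)) (fun i => (f i).op)}

/-- The fpqc topology on `CAlg_kᵒᵖ`. -/
def fpqcTopology : GrothendieckTopology (CommAlgCat.{u} k)ᵒᵖ :=
  (fpqcPrecoverage k).toGrothendieck

/-- The category of fpqc sheaves over `k`: accessible sheaves of sets on `CAlg_kᵒᵖ` with the
fpqc topology. -/
abbrev FpqcSheaf := AccSheaf (fpqcTopology k)

end Fpqc

/-! ### Stone algebras and Stone duality -/

section Stone

variable (k : Type u) [CommRing k]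

/-- The `k`-algebras isomorphic to `k ^ S` for a finite set `S`. -/
def isFinitePower : ObjectProperty (CommAlgCat.{u} k) :=
  fun A => ∃ (S : Type u) (_ : Finite S), Nonempty (A ≅ CommAlgCat.of k (S → k))

/-- Stone `k`-algebras: the closure under small filtered colimits, in all commutative
`k`-algebras, of the algebras `k ^ S` for finite sets `S`. -/
def isStone : ObjectProperty (CommAlgCat.{u} k) :=
  (isFinitePower k).colimitsClosure
    (fun J : {J : Cat.{u, u} // IsFiltered J} => (J.1 : Type u))

/-- The category of Stone `k`-algebras. -/
abbrev StoneAlg := (isStone k).FullSubcategory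

/-- The contravariant functor `S ↦ C(S, k)`, where `C(S, k)` is the `k`-algebra of continuous
functions from the profinite set `S` to the discrete set `k` (that is, of locally constant
functions), viewed as a covariant functor `Profinite ⥤ CAlg_kᵒᵖ`. -/
def continuousFunctions : Profinite.{u} ⥤ (CommAlgCat.{u} k)ᵒᵖ where
  obj S := op (CommAlgCat.of k (LocallyConstant S k))
  map g := (CommAlgCat.ofHom (LocallyConstant.comapₐ k g.hom.hom)).op
  map_id _ := rfl
  map_comp _ _ := rfl

end Stone

end Petra

open Petra

/-! Write `π₀ A` for the Stone space of the idempotents of `A`. Over a field, homomorphisms `C(S, k)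
→ A` correspond to continuous maps `π₀ A → S`: in each local ring of `A` such a homomorphism is
evaluation at a point of `S`, and this point depends only on the component. Hence `S ↦ C(S, k)`, as
a functor to `CAlg_kᵒᵖ`, has the left adjoint `π₀`. Its counit is invertible because the primes of
`C(S, k)` are the points of `S`; this gives full faithfulness. The canonical map `C(π₀ A, k) → A` is
always injective, and its surjectivity passes to filtered colimits, which gives Stone duality.

At the level of presheaves the left adjoint to restriction along `C(-, k)` is therefore `X ↦ X(π₀
-)`, and `f^*` should be its fpqc sheafification. As the site is large, the sheafification is
described explicitly: `f^*X(A)` consists of the sections of `X` over `Spec A` with the constructible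
topology whose two restrictions to the profinite set of pairs `p ≤ q` agree. This is a sheaf because
flat maps satisfy going-down (`isSheaf_comparableSections`). The map from `X(π₀ A)` is injective,
and locally surjective by the cover built in `exists_flat_cover_components`; these two properties
give the universal property (`bijective_precomp_of_locally_bijective`).

The formula for `f^*` visibly preserves limits, and it preserves accessibility because constructible
spectra turn filtered colimits of algebras into limits. For `A = C(S, k)` both the constructible
spectrum and `π₀` are `S`, so the unit is an isomorphism and `f^*` is fully faithful. -/

namespace Petra

/-! ### The constructible topology on the prime spectrum -/

section ConstructibleSpectrum

/-- The prime spectrum with the constructible topology. -/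
structure ConstructibleSpec (A : Type u) [CommRing A] : Type u where
  /-- The underlying point of the prime spectrum. -/
  toPrimeSpectrum : PrimeSpectrum A

variable {A B : Type u} [CommRing A] [CommRing B]

/-- The ideal underlying a point of the constructible spectrum. -/
abbrev ConstructibleSpec.asIdeal (p : ConstructibleSpec A) : Ideal A :=
  p.toPrimeSpectrum.asIdeal

lemma ConstructibleSpec.toPrimeSpectrum_injective :
    Function.Injective (toPrimeSpectrum (A := A)) := by
  rintro ⟨p⟩ ⟨q⟩ h
  exact congrArg mk h

instance : PartialOrder (ConstructibleSpec A) :=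
  PartialOrder.lift _ ConstructibleSpec.toPrimeSpectrum_injective

lemma ConstructibleSpec.le_iff {p q : ConstructibleSpec A} :
    p ≤ q ↔ ∀ a ∈ p.asIdeal, a ∈ q.asIdeal := Iff.rfl

@[ext]
lemma ConstructibleSpec.ext {p q : ConstructibleSpec A}
    (h : ∀ a, a ∈ p.asIdeal ↔ a ∈ q.asIdeal) : p = q :=
  ConstructibleSpec.toPrimeSpectrum_injective (PrimeSpectrum.ext (Ideal.ext h))

open Classical in
/-- The indicator function of a prime ideal. -/
noncomputable def primeIndicator (A : Type u) [CommRing A] (p : ConstructibleSpec A) : A → Bool :=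
  fun a => decide (a ∈ p.asIdeal)

noncomputable instance : TopologicalSpace (ConstructibleSpec A) :=
  TopologicalSpace.induced (primeIndicator A) inferInstance

lemma primeIndicator_eq_true {p : ConstructibleSpec A} {a : A} :
    primeIndicator A p a = true ↔ a ∈ p.asIdeal := by
  simp [primeIndicator]

lemma continuous_constructibleSpec_iff {X : Type*} [TopologicalSpace X]
    {f : X → ConstructibleSpec A} :
    Continuous f ↔ ∀ a, IsClopen {x | a ∈ (f x).asIdeal} := by
  rw [continuous_induced_rng, continuous_pi_iff]
  refine forall_congr' fun a => ?_
  rw [continuous_bool_rng true]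
  convert Iff.rfl using 2
  ext x
  exact primeIndicator_eq_true.symm

lemma isClopen_setOf_mem_asIdeal (a : A) :
    IsClopen {p : ConstructibleSpec A | a ∈ p.asIdeal} :=
  continuous_constructibleSpec_iff.1 continuous_id a

lemma primeIndicator_injective : Function.Injective (primeIndicator A) := by
  intro p q h
  refine ConstructibleSpec.ext fun a => ?_
  rw [← primeIndicator_eq_true, ← primeIndicator_eq_true, h]

/-- Being a prime ideal is a conjunction of conditions that each involve at most three values of the
indicator, hence each is clopen in the product. The condition on products encodes both absorption
and primality. -/
lemma isClosed_range_primeIndicator : IsClosed (Set.range (primeIndicator A)) := by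
  have : Set.range (primeIndicator A) =
      {χ | χ 0 = true} ∩ {χ | χ 1 = false} ∩
      (⋂ (a : A) (b : A), {χ | χ a = true → χ b = true → χ (a + b) = true}) ∩
      (⋂ (a : A) (b : A), {χ | χ (a * b) = true ↔ (χ a = true ∨ χ b = true)}) := by
    ext χ
    constructor
    · rintro ⟨p, rfl⟩
      have h1 : (1 : A) ∉ p.asIdeal := fun h => p.1.2.ne_top ((Ideal.eq_top_iff_one _).2 h)
      simp only [primeIndicator, Set.mem_inter_iff, Set.mem_iInter, Set.mem_ofPred_eq,
        decide_eq_true_eq, decide_eq_false_iff_not]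
      exact ⟨⟨⟨p.asIdeal.zero_mem, h1⟩, fun a b => p.asIdeal.add_mem⟩,
        fun a b => p.1.2.mul_mem_iff_mem_or_mem⟩
    · simp only [Set.mem_inter_iff, Set.mem_iInter, Set.mem_ofPred_eq]
      rintro ⟨⟨⟨h0, h1⟩, hadd⟩, hmul⟩
      let I : Ideal A :=
        { carrier := {a | χ a = true}
          add_mem' := fun {a b} => hadd a b
          zero_mem' := h0
          smul_mem' := fun c a ha => (hmul c a).2 (Or.inr ha) }
      have hI : I.IsPrime :=
        { ne_top' := by
            rw [Ne, Ideal.eq_top_iff_one]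
            change ¬ (χ 1 = true)
            simp [h1]
          mem_or_mem' := fun {a b} => (hmul a b).1 }
      refine ⟨⟨⟨I, hI⟩⟩, ?_⟩
      ext a
      rw [Bool.eq_iff_iff]
      exact primeIndicator_eq_true (p := ⟨⟨I, hI⟩⟩)
  rw [this]
  have c (a : A) : Continuous fun χ : A → Bool => χ a := continuous_apply a
  refine IsClosed.inter (IsClosed.inter (IsClosed.inter ?_ ?_) ?_) ?_
  · exact isClosed_eq (c 0) continuous_const
  · exact isClosed_eq (c 1) continuous_const
  · refine isClosed_iInter fun a => isClosed_iInter fun b => ?_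
    exact (isClosed_discrete {t : Bool × Bool × Bool | t.1 = true → t.2.1 = true →
      t.2.2 = true}).preimage ((c a).prodMk ((c b).prodMk (c (a + b))))
  · refine isClosed_iInter fun a => isClosed_iInter fun b => ?_
    exact (isClosed_discrete {t : Bool × Bool × Bool | t.1 = true ↔ (t.2.1 = true ∨
      t.2.2 = true)}).preimage ((c (a * b)).prodMk ((c a).prodMk (c b)))

lemma isClosedEmbedding_primeIndicator :
    Topology.IsClosedEmbedding (X := ConstructibleSpec A) (primeIndicator A) :=
  ⟨⟨⟨rfl⟩, primeIndicator_injective⟩, isClosed_range_primeIndicator⟩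

instance : CompactSpace (ConstructibleSpec A) :=
  isClosedEmbedding_primeIndicator.compactSpace

instance : T2Space (ConstructibleSpec A) :=
  isClosedEmbedding_primeIndicator.isEmbedding.t2Space

instance : TotallyDisconnectedSpace (ConstructibleSpec A) := by
  refine ⟨isClosedEmbedding_primeIndicator.isEmbedding.isTotallyDisconnected ?_⟩
  exact isTotallyDisconnected_of_totallyDisconnectedSpace _

/-- The map on constructible spectra induced by a ring homomorphism. -/
def ConstructibleSpec.comap (f : A →+* B) (p : ConstructibleSpec B) : ConstructibleSpec A :=
  ⟨PrimeSpectrum.comap f p.toPrimeSpectrum⟩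

lemma ConstructibleSpec.continuous_comap (f : A →+* B) : Continuous (comap f) :=
  continuous_constructibleSpec_iff.2 fun a => isClopen_setOf_mem_asIdeal (f a)

lemma ConstructibleSpec.comap_mono (f : A →+* B) : Monotone (comap f) :=
  fun _ _ h _ ha => h ha

variable (A) in
/-- The space of pairs of comparable points of the constructible spectrum. -/
abbrev SpecializationPairs : Type u :=
  {x : ConstructibleSpec A × ConstructibleSpec A // x.1 ≤ x.2}

lemma isClosed_specializations :
    IsClosed {x : ConstructibleSpec A × ConstructibleSpec A | x.1 ≤ x.2} := by
  have : {x : ConstructibleSpec A × ConstructibleSpec A | x.1 ≤ x.2} =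
      ⋂ a, ((Prod.fst ⁻¹' {p : ConstructibleSpec A | a ∈ p.asIdeal}ᶜ) ∪
        (Prod.snd ⁻¹' {p : ConstructibleSpec A | a ∈ p.asIdeal})) := by
    ext x
    simp [ConstructibleSpec.le_iff, imp_iff_not_or]
  rw [this]
  exact isClosed_iInter fun a =>
    ((isClopen_setOf_mem_asIdeal a).compl.isClosed.preimage continuous_fst).union
      ((isClopen_setOf_mem_asIdeal a).isClosed.preimage continuous_snd)

instance : CompactSpace (SpecializationPairs A) :=
  isCompact_iff_compactSpace.1 isClosed_specializations.isCompact

end ConstructibleSpectrum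

/-! ### The space of components of the prime spectrum -/

section Components

variable {A B : Type u} [CommRing A] [CommRing B]

open Classical in
/-- The indicator function of a prime ideal on idempotents. -/
noncomputable def idempotentIndicator (A : Type u) [CommRing A] (p : PrimeSpectrum A) :
    {e : A // IsIdempotentElem e} → Bool :=
  fun e => decide (e.1 ∈ p.asIdeal)

lemma idempotentIndicator_eq_true {p : PrimeSpectrum A} {e : {e : A // IsIdempotentElem e}} :
    idempotentIndicator A p e = true ↔ e.1 ∈ p.asIdeal := by
  simp [idempotentIndicator]

lemma idempotentIndicator_eq_iff {p q : PrimeSpectrum A} :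
    idempotentIndicator A p = idempotentIndicator A q ↔
      ∀ e : A, IsIdempotentElem e → (e ∈ p.asIdeal ↔ e ∈ q.asIdeal) := by
  rw [funext_iff, Subtype.forall]
  refine forall₂_congr fun e he => ?_
  rw [Bool.eq_iff_iff, idempotentIndicator_eq_true, idempotentIndicator_eq_true]

lemma isClopen_setOf_idempotent_mem {e : A} (he : IsIdempotentElem e) :
    IsClopen {p : PrimeSpectrum A | e ∈ p.asIdeal} := by
  rw [PrimeSpectrum.isClopen_iff_zeroLocus]
  refine ⟨e, he, ?_⟩
  ext p
  simp [PrimeSpectrum.mem_zeroLocus]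

lemma continuous_idempotentIndicator : Continuous (idempotentIndicator A) := by
  rw [continuous_pi_iff]
  intro e
  rw [continuous_bool_rng true]
  convert isClopen_setOf_idempotent_mem e.2 using 1
  ext p
  exact idempotentIndicator_eq_true

/-- The Stone space of the Boolean algebra of idempotents of a ring, as a quotient of the prime
spectrum. -/
abbrev SpecComponents (A : Type u) [CommRing A] : Type u := Set.range (idempotentIndicator A)

instance : CompactSpace (SpecComponents A) :=
  isCompact_iff_compactSpace.1 (isCompact_range continuous_idempotentIndicator)

/-- The quotient map from the prime spectrum to its space of components. -/
noncomputable def toSpecComponents (p : PrimeSpectrum A) : SpecComponents A := ⟨_, p, rfl⟩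

lemma toSpecComponents_surjective : Function.Surjective (toSpecComponents (A := A)) := by
  rintro ⟨_, p, rfl⟩
  exact ⟨p, rfl⟩

lemma continuous_toSpecComponents : Continuous (toSpecComponents (A := A)) :=
  continuous_idempotentIndicator.subtype_mk _

lemma toSpecComponents_eq_iff {p q : PrimeSpectrum A} :
    toSpecComponents p = toSpecComponents q ↔
      ∀ e : A, IsIdempotentElem e → (e ∈ p.asIdeal ↔ e ∈ q.asIdeal) := by
  rw [← idempotentIndicator_eq_iff]
  exact Subtype.ext_iff

/-- Since `e * (1 - e) = 0`, an idempotent outside `p` has `1 - e` in `p`, hence in `q`. This is why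
sections pulled back from the components satisfy the comparability condition. -/
lemma toSpecComponents_eq_of_le {p q : PrimeSpectrum A} (h : p ≤ q) :
    toSpecComponents p = toSpecComponents q := by
  rw [toSpecComponents_eq_iff]
  refine fun e he => ⟨fun hp => h hp, fun hq => ?_⟩
  have : e * (1 - e) ∈ p.asIdeal := by
    rw [mul_sub, mul_one, he.eq, sub_self]
    exact p.asIdeal.zero_mem
  refine (p.2.mem_or_mem this).resolve_right fun h1 => q.2.ne_top ?_
  rw [Ideal.eq_top_iff_one]
  simpa using q.asIdeal.add_mem hq (h h1)

/-- The map on spaces of components induced by a ring homomorphism. -/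
def SpecComponents.comap (f : A →+* B) (x : SpecComponents B) : SpecComponents A :=
  ⟨fun e => x.1 ⟨f e.1, e.2.map f⟩, by
    obtain ⟨_, p, rfl⟩ := x
    exact ⟨PrimeSpectrum.comap f p, rfl⟩⟩

lemma SpecComponents.continuous_comap (f : A →+* B) : Continuous (comap f) :=
  Continuous.subtype_mk (continuous_pi fun e =>
    (continuous_apply (⟨f e.1, e.2.map f⟩ : {e : B // IsIdempotentElem e})).comp
      continuous_subtype_val) _

/-- A continuous map from the prime spectrum to a profinite space factors through the space of
components. -/
lemma exists_factor_toSpecComponents {S : Type*} [TopologicalSpace S] [CompactSpace S] [T2Space S]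
    [TotallyDisconnectedSpace S] {g : PrimeSpectrum A → S} (hg : Continuous g) :
    ∃ h : C(SpecComponents A, S), ∀ p, h (toSpecComponents p) = g p := by
  -- A clopen set separating `g p` from `g q` pulls back to the zero locus of an idempotent, which
  -- then distinguishes the two components.
  have key (p q : PrimeSpectrum A) (hpq : toSpecComponents p = toSpecComponents q) :
      g p = g q := by
    by_contra hne
    obtain ⟨U, hU, hpU, hqU⟩ := exists_isClopen_of_totally_separated hne
    obtain ⟨e, he, heU⟩ := PrimeSpectrum.isClopen_iff_zeroLocus.1 (hU.preimage hg)
    have h1 (r : PrimeSpectrum A) : e ∈ r.asIdeal ↔ g r ∈ U := by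
      rw [← Set.mem_preimage, heU]
      simp [PrimeSpectrum.mem_zeroLocus]
    have := toSpecComponents_eq_iff.1 hpq e he
    rw [h1, h1] at this
    exact hqU (this.1 hpU)
  let h : SpecComponents A → S := fun x => g (toSpecComponents_surjective x).choose
  have hh (p) : h (toSpecComponents p) = g p :=
    key _ _ (toSpecComponents_surjective (toSpecComponents p)).choose_spec
  refine ⟨⟨h, ?_⟩, hh⟩
  rw [isTopologicalBasis_isClopen.continuous_iff]
  intro U hU
  obtain ⟨e, he, heU⟩ := PrimeSpectrum.isClopen_iff_zeroLocus.1 (IsClopen.preimage hU hg)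
  have : h ⁻¹' U = Subtype.val ⁻¹' ((fun χ => χ ⟨e, he⟩) ⁻¹' {true}) := by
    ext x
    obtain ⟨p, rfl⟩ := toSpecComponents_surjective x
    rw [Set.mem_preimage, hh, ← Set.mem_preimage, heU]
    have h1 : p ∈ PrimeSpectrum.zeroLocus {e} ↔ e ∈ p.asIdeal := by
      simp [PrimeSpectrum.mem_zeroLocus]
    exact h1.trans (idempotentIndicator_eq_true (e := ⟨e, he⟩)).symm
  rw [this]
  exact ((isOpen_discrete _).preimage (continuous_apply _)).preimage continuous_subtype_val

end Components

/-! ### Locally constant functions on the prime spectrum -/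

section GlobalSections

variable {k : Type u} [Field k] {A : Type u} [CommRing A] [Algebra k A]

lemma eq_of_forall_localization {a b : A}
    (h : ∀ p : PrimeSpectrum A, algebraMap A (Localization.AtPrime p.asIdeal) a =
      algebraMap A (Localization.AtPrime p.asIdeal) b) : a = b :=
  PrimeSpectrum.toPiLocalization_injective A (funext h)

lemma isIdempotentElem_localRing {D : Type*} [CommRing D] [IsLocalRing D] {e : D}
    (he : IsIdempotentElem e) : e = 0 ∨ e = 1 := by
  have h : e * (1 - e) = 0 := by rw [mul_sub, mul_one, he.eq, sub_self]
  rcases IsLocalRing.isUnit_or_isUnit_one_sub_self e with hu | hu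
  · exact Or.inr (sub_eq_zero.1 (hu.mul_right_eq_zero.1 h)).symm
  · exact Or.inl (hu.mul_left_eq_zero.1 h)

lemma isUnit_algebraMap_localization_iff (p : PrimeSpectrum A) (a : A) :
    IsUnit (algebraMap A (Localization.AtPrime p.asIdeal) a) ↔ a ∉ p.asIdeal :=
  IsLocalization.AtPrime.isUnit_to_map_iff _ p.asIdeal a

/-- The function has finitely many level sets, each cut out by an idempotent; the section is the sum
of these idempotents weighted by the values. -/
lemma exists_globalSection (f : LocallyConstant (PrimeSpectrum A) k) :
    ∃ a : A, ∀ p : PrimeSpectrum A, algebraMap A (Localization.AtPrime p.asIdeal) a =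
      algebraMap A (Localization.AtPrime p.asIdeal) (algebraMap k A (f p)) := by
  classical
  -- The zero locus of `e c` is the complement of the fibre over `c`, so `e c` is the indicator of
  -- the fibre itself.
  choose e he hef using fun c : k =>
    PrimeSpectrum.isClopen_iff_zeroLocus.1 ((f.isLocallyConstant.isClopen_fiber c).compl)
  have hmem (c : k) (p : PrimeSpectrum A) : e c ∈ p.asIdeal ↔ f p ≠ c := by
    have : p ∈ PrimeSpectrum.zeroLocus {e c} ↔ f p ≠ c := by
      rw [← hef]
      rfl
    rw [← this]
    simp [PrimeSpectrum.mem_zeroLocus]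
  have hloc (c : k) (p : PrimeSpectrum A) :
      algebraMap A (Localization.AtPrime p.asIdeal) (e c) = if f p = c then 1 else 0 := by
    have hid := (he c).map (algebraMap A (Localization.AtPrime p.asIdeal))
    have hunit : IsUnit (algebraMap A (Localization.AtPrime p.asIdeal) (e c)) ↔ f p = c := by
      rw [isUnit_algebraMap_localization_iff, hmem, not_not]
    split_ifs with h
    · exact (isIdempotentElem_localRing hid).resolve_left
        fun h0 => not_isUnit_zero (h0 ▸ hunit.2 h)
    · exact (isIdempotentElem_localRing hid).resolve_right
        fun h1 => h (hunit.1 (h1 ▸ isUnit_one))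
  refine ⟨∑ c ∈ f.range_finite.toFinset, algebraMap k A c * e c, fun p => ?_⟩
  rw [map_sum, Finset.sum_eq_single (f p)]
  · rw [map_mul, hloc, if_pos rfl, mul_one]
  · intro c _ hc
    rw [map_mul, hloc, if_neg hc.symm, mul_zero]
  · intro h
    exact absurd (f.range_finite.mem_toFinset.2 (Set.mem_range_self p)) h

variable (k A) in
/-- A locally constant function on the prime spectrum of a `k`-algebra with values in `k`, as an
element of the algebra. -/
noncomputable def globalSection : LocallyConstant (PrimeSpectrum A) k →ₐ[k] A where
  -- The chosen element is determined by its germs, so all the algebra identities can be checked in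
  -- the localizations.
  toFun f := (exists_globalSection f).choose
  map_one' := eq_of_forall_localization fun p => by
    rw [(exists_globalSection _).choose_spec p]; simp
  map_mul' f g := eq_of_forall_localization fun p => by
    rw [map_mul]; simp only [(exists_globalSection _).choose_spec p]; simp
  map_zero' := eq_of_forall_localization fun p => by
    rw [(exists_globalSection _).choose_spec p]; simp
  map_add' f g := eq_of_forall_localization fun p => by
    rw [map_add]; simp only [(exists_globalSection _).choose_spec p]; simp
  commutes' c := eq_of_forall_localization fun p => by
    rw [(exists_globalSection _).choose_spec p]; simp

lemma algebraMap_globalSection (f : LocallyConstant (PrimeSpectrum A) k) (p : PrimeSpectrum A) :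
    algebraMap A (Localization.AtPrime p.asIdeal) (globalSection k A f) =
      algebraMap A (Localization.AtPrime p.asIdeal) (algebraMap k A (f p)) :=
  (exists_globalSection f).choose_spec p

lemma algebraMap_mem_iff (c : k) (p : Ideal A) [hp : p.IsPrime] :
    algebraMap k A c ∈ p ↔ c = 0 := by
  refine ⟨fun h => ?_, fun h => by rw [h, map_zero]; exact p.zero_mem⟩
  by_contra hc
  exact hp.ne_top (p.eq_top_of_isUnit_mem h ((IsUnit.mk0 c hc).map _))

lemma globalSection_mem_iff (f : LocallyConstant (PrimeSpectrum A) k) (p : PrimeSpectrum A) :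
    globalSection k A f ∈ p.asIdeal ↔ f p = 0 := by
  rw [← algebraMap_mem_iff (A := A) (f p) p.asIdeal,
    ← not_iff_not, ← isUnit_algebraMap_localization_iff, algebraMap_globalSection,
    isUnit_algebraMap_localization_iff]

/-- An algebra homomorphism from locally constant functions on a compact space to an algebra
without nontrivial idempotents is the evaluation at some point. -/
lemma exists_eval_eq {S : Type*} [TopologicalSpace S] [CompactSpace S] {D : Type*} [CommRing D]
    [Nontrivial D] [Algebra k D] (hD : ∀ e : D, IsIdempotentElem e → e = 0 ∨ e = 1)
    (ψ : LocallyConstant S k →ₐ[k] D) : ∃ s, ∀ f, ψ f = algebraMap k D (f s) := by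
  classical
  by_contra! H
  -- If no point works, each `s` has a witness `f s`. The difference `f s - f s s` is supported off
  -- the level set `U s`, so the indicator `e s` of the complement cannot be killed by `ψ`, whence
  -- `ψ (e s) = 1`. By compactness a finite product of the `e s` is zero, contradicting `1 ≠ 0`.
  choose f hf using H
  let U (s : S) : Set S := {t | f s t = f s s}
  have hU (s : S) : IsClopen (U s) := (f s).isLocallyConstant.isClopen_fiber _
  let e (s : S) : LocallyConstant S k := LocallyConstant.charFn k (hU s).compl
  have he (s : S) : IsIdempotentElem (e s) := by
    ext t
    by_cases h : t ∈ U s <;> simp [e, LocallyConstant.coe_charFn, h]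
  have hmul (s : S) : (f s - algebraMap k _ (f s s)) * e s = f s - algebraMap k _ (f s s) := by
    ext t
    by_cases h : t ∈ U s
    · have h' : (f s - algebraMap k _ (f s s)) t = 0 := sub_eq_zero.2 h
      rw [LocallyConstant.mul_apply, h', zero_mul]
    · simp [e, LocallyConstant.coe_charFn, h]
  have h1 (s : S) : ψ (e s) = 1 := by
    refine (hD _ ((he s).map ψ)).resolve_left fun h0 => hf s ?_
    have := congrArg ψ (hmul s)
    rw [map_mul, h0, mul_zero, map_sub, AlgHom.commutes] at this
    exact sub_eq_zero.1 this.symm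
  obtain ⟨t, ht⟩ := isCompact_univ.elim_finite_subcover U (fun s => (hU s).isOpen)
    fun s _ => Set.mem_iUnion.2 ⟨s, rfl⟩
  have hprod : ∏ s ∈ t, e s = 0 := by
    ext x
    obtain ⟨s, hs, hx⟩ := Set.mem_iUnion₂.1 (ht (Set.mem_univ x))
    have h0 : e s x = 0 := by simp [e, LocallyConstant.coe_charFn, hx]
    exact (map_prod (LocallyConstant.evalₐ k x) e t).trans (Finset.prod_eq_zero hs h0)
  have := congrArg ψ hprod
  rw [map_prod, Finset.prod_congr rfl (fun s _ => h1 s), Finset.prod_const_one, map_zero] at this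
  exact one_ne_zero this

variable {S : Type*} [TopologicalSpace S]

/-- The homomorphism of algebras attached to a map from the space of components. -/
noncomputable def componentsHom (h : C(SpecComponents A, S)) : LocallyConstant S k →ₐ[k] A :=
  (globalSection k A).comp
    (LocallyConstant.comapₐ k (h.comp ⟨toSpecComponents, continuous_toSpecComponents⟩))

lemma componentsHom_mem_iff (h : C(SpecComponents A, S)) (f : LocallyConstant S k)
    (p : PrimeSpectrum A) :
    componentsHom h f ∈ p.asIdeal ↔ f (h (toSpecComponents p)) = 0 :=
  globalSection_mem_iff _ p

lemma componentsHom_injective [CompactSpace S] [T2Space S] [TotallyDisconnectedSpace S] :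
    Function.Injective (componentsHom (k := k) (A := A) (S := S)) := by
  intro h₁ h₂ h
  ext x
  obtain ⟨p, rfl⟩ := toSpecComponents_surjective x
  by_contra hne
  obtain ⟨U, hU, h1, h2⟩ := exists_isClopen_of_totally_separated hne
  have e1 := componentsHom_mem_iff h₁ (LocallyConstant.charFn k hU) p
  rw [h, componentsHom_mem_iff h₂] at e1
  have h2' : h₂ (toSpecComponents p) ∉ U := h2
  simp [LocallyConstant.coe_charFn, h1, h2'] at e1

/-- In the local ring at `p` the homomorphism is evaluation at some `g p`. Idempotents of `C(S, k)`
map to idempotents of `A`, so `g` is continuous and factors through the components. -/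
lemma componentsHom_surjective [CompactSpace S] [T2Space S] [TotallyDisconnectedSpace S] :
    Function.Surjective (componentsHom (k := k) (A := A) (S := S)) := by
  intro ψ
  have H (p : PrimeSpectrum A) := exists_eval_eq (fun _ => isIdempotentElem_localRing)
    ((IsScalarTower.toAlgHom k A (Localization.AtPrime p.asIdeal)).comp ψ)
  choose g hg using H
  have hg' (p : PrimeSpectrum A) (f : LocallyConstant S k) : ψ f ∈ p.asIdeal ↔ f (g p) = 0 := by
    rw [← algebraMap_mem_iff (A := A) (f (g p)) p.asIdeal,
      ← not_iff_not, ← isUnit_algebraMap_localization_iff]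
    have := hg p f
    rw [AlgHom.comp_apply, IsScalarTower.toAlgHom_apply] at this
    rw [this, IsScalarTower.algebraMap_apply k A, isUnit_algebraMap_localization_iff]
  have hcont : Continuous g := by
    rw [isTopologicalBasis_isClopen.continuous_iff]
    intro U hU
    have hc : IsIdempotentElem (LocallyConstant.charFn k (IsClopen.compl hU)) := by
      ext t
      by_cases h : t ∈ U <;> simp [LocallyConstant.coe_charFn, h]
    convert (isClopen_setOf_idempotent_mem (hc.map ψ)).isOpen using 1
    ext p
    refine Iff.trans ?_ (hg' p _).symm
    by_cases h : g p ∈ U <;> simp [LocallyConstant.coe_charFn, h]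
  obtain ⟨h, hh⟩ := exists_factor_toSpecComponents hcont
  refine ⟨h, AlgHom.ext fun f => eq_of_forall_localization fun p => ?_⟩
  refine (algebraMap_globalSection _ p).trans ?_
  refine Eq.trans ?_ (hg p f).symm
  rw [IsScalarTower.algebraMap_apply k A]
  exact congrArg (fun s => algebraMap A _ (algebraMap k A (f s))) (hh p)

end GlobalSections

/-! ### Prime ideals of algebras of locally constant functions -/

section LocallyConstantPrimes

variable {k : Type u} [Field k] {S : Type*} [TopologicalSpace S]

variable (k) in
/-- The prime ideal of locally constant functions vanishing at a point. -/
noncomputable def evalPrime (s : S) : PrimeSpectrum (LocallyConstant S k) :=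
  ⟨RingHom.ker (LocallyConstant.evalₐ k s), RingHom.ker_isPrime _⟩

lemma mem_evalPrime {s : S} {f : LocallyConstant S k} :
    f ∈ (evalPrime k s).asIdeal ↔ f s = 0 := Iff.rfl

/-- The quotient by a prime is a domain, so it has only trivial idempotents and `exists_eval_eq`
applies to the quotient map. -/
lemma exists_eq_evalPrime [CompactSpace S] (p : PrimeSpectrum (LocallyConstant S k)) :
    ∃ s, p = evalPrime k s := by
  obtain ⟨s, hs⟩ := exists_eval_eq (D := LocallyConstant S k ⧸ p.asIdeal)
    (fun e he => by
      have : e * (e - 1) = 0 := by rw [mul_sub, mul_one, he.eq, sub_self]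
      exact (mul_eq_zero.1 this).imp id sub_eq_zero.1) (Ideal.Quotient.mkₐ k p.asIdeal)
  refine ⟨s, PrimeSpectrum.ext (Ideal.ext fun f => ?_)⟩
  rw [← Ideal.Quotient.eq_zero_iff_mem, mem_evalPrime, ← Ideal.Quotient.mkₐ_eq_mk k, hs,
    map_eq_zero_iff _ (algebraMap k (LocallyConstant S k ⧸ p.asIdeal)).injective]

end LocallyConstantPrimes


/-! ### Flatness and locally constant functions -/

section Flat

/-- Locally constant functions with values in a ring form a flat module. -/
instance {A S : Type*} [CommRing A] [TopologicalSpace S] [CompactSpace S] :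
    Module.Flat A (LocallyConstant S A) := by
  classical
  rw [Module.Flat.iff_forall_isTrivialRelation]
  intro l f x h
  -- The `x i` together form one function with finitely many values. Each value is a solution in `A`
  -- of the given relation, and `x` is the combination of these solutions with indicator functions
  -- as coefficients.
  let X : LocallyConstant S (Fin l → A) := LocallyConstant.unflip x
  have := X.range_finite.fintype
  let e := (Fintype.equivFin (Set.range X)).symm
  refine ⟨_, fun i j => (e j).1 i,
    fun j => LocallyConstant.charFn A (X.isLocallyConstant.isClopen_fiber (e j).1),
    fun i => ?_, fun j => ?_⟩
  · ext s
    refine Eq.trans ?_ (map_sum (LocallyConstant.evalₐ A s) _ _).symm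
    rw [Finset.sum_eq_single (e.symm ⟨X s, s, rfl⟩)]
    · have h1 : (e (e.symm ⟨X s, s, rfl⟩)).1 = X s := by rw [Equiv.apply_symm_apply]
      have : LocallyConstant.charFn A (X.isLocallyConstant.isClopen_fiber (X s)) s = 1 := by
        rw [LocallyConstant.coe_charFn]
        exact Set.indicator_of_mem (s := {t | X.toFun t = X s}) rfl 1
      change x i s = (e (e.symm ⟨X s, s, rfl⟩)).1 i •
        LocallyConstant.charFn A (X.isLocallyConstant.isClopen_fiber
          (e (e.symm ⟨X s, s, rfl⟩)).1) s
      simp only [h1, this, smul_eq_mul, mul_one]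
      rfl
    · intro j _ hj
      have : LocallyConstant.charFn A (X.isLocallyConstant.isClopen_fiber (e j).1) s = 0 := by
        rw [LocallyConstant.coe_charFn]
        refine Set.indicator_of_notMem (s := {t | X.toFun t = (e j).1}) (fun h => hj ?_) 1
        rw [Equiv.eq_symm_apply]
        exact Subtype.ext h.symm
      change (e j).1 i • LocallyConstant.charFn A _ s = 0
      rw [this, smul_zero]
    · simp
  · obtain ⟨s, hs⟩ := (e j).2
    have := congrArg (LocallyConstant.evalₐ A s) h
    rw [map_sum, map_zero] at this
    change ∑ i, f i * (e j).1 i = 0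
    rw [← hs]
    exact this

/-- Finitely generated ideals of `C(S, k)` are generated by idempotents: inverting a nonzero
coordinate pointwise gives `g` with `f j * ∑ f i * g i = f j`. The matrix `δ i j - g i * f j` then
trivializes the relation `∑ f i • x i = 0`. -/
instance {k S M : Type*} [Field k] [TopologicalSpace S] [AddCommGroup M]
    [Module (LocallyConstant S k) M] : Module.Flat (LocallyConstant S k) M := by
  classical
  rw [Module.Flat.iff_forall_isTrivialRelation]
  intro l f x h
  have H (v : Fin l → k) : ∃ w : Fin l → k, ∀ j, v j = v j * ∑ i, v i * w i := by
    by_cases hv : v = 0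
    · exact ⟨0, fun j => by simp [hv]⟩
    · obtain ⟨i, hi⟩ := Function.ne_iff.1 hv
      refine ⟨Pi.single i (v i)⁻¹, fun j => ?_⟩
      rw [Finset.sum_eq_single i]
      · rw [Pi.single_eq_same, mul_inv_cancel₀ hi, mul_one]
      · intro b _ hb
        rw [Pi.single_eq_of_ne hb, mul_zero]
      · simp
  choose γ hγ using H
  let g (i : Fin l) : LocallyConstant S k := (LocallyConstant.unflip f).map fun v => γ v i
  have hg (j : Fin l) : f j * ∑ i, f i * g i = f j := by
    ext s
    have h1 : (∑ i, f i * g i : LocallyConstant S k) s = ∑ i, f i s * g i s :=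
      map_sum (LocallyConstant.evalₐ k s) (fun i => f i * g i) _
    rw [LocallyConstant.mul_apply, h1]
    exact (hγ (fun j => f j s) j).symm
  refine ⟨l, fun i j => (if i = j then 1 else 0) - g i * f j, x, fun i => ?_, fun j => ?_⟩
  · simp only [sub_smul, Finset.sum_sub_distrib, mul_smul, ← Finset.smul_sum, h, smul_zero,
      sub_zero]
    simp
  · simp only [mul_sub, Finset.sum_sub_distrib, mul_ite, mul_one, mul_zero]
    rw [Finset.sum_ite_eq' Finset.univ j, if_pos (Finset.mem_univ j)]
    rw [sub_eq_zero]
    refine (hg j).symm.trans ?_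
    rw [Finset.mul_sum]
    exact Finset.sum_congr rfl fun i _ => by ring

end Flat

/-! ### Amalgamated sums of algebras -/

section Pushout

open TensorProduct

lemma exists_common_field_extension {K L M : Type u} [Field K] [Field L] [Field M]
    (f : K →+* L) (g : K →+* M) :
    ∃ (T : Type u) (_ : Field T) (i : L →+* T) (j : M →+* T), i.comp f = j.comp g := by
  algebraize [f, g]
  obtain ⟨m, hm⟩ := Ideal.exists_maximal (L ⊗[K] M)
  refine ⟨(L ⊗[K] M) ⧸ m, Ideal.Quotient.field m,
    (Ideal.Quotient.mk m).comp Algebra.TensorProduct.includeLeftRingHom,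
    (Ideal.Quotient.mk m).comp Algebra.TensorProduct.includeRight.toRingHom, ?_⟩
  ext x
  refine congrArg (Ideal.Quotient.mk m) ?_
  exact (Algebra.TensorProduct.includeLeft.commutes x).trans
    (Algebra.TensorProduct.includeRight (R := K) (A := L) (B := M).commutes x).symm

variable {k : Type u} [CommRing k] {A B C : Type u} [CommRing A] [CommRing B] [CommRing C]
  [Algebra k A] [Algebra k B] [Algebra k C]

/-- The witness is `C ⊗[A] B`. Points with the same image lift to it because their residue fields
have a common extension. This lets sections be compared on the spectrum of the tensor product
instead of on a fibre product of spectra. -/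
lemma exists_pushout (f : A →ₐ[k] B) (g : A →ₐ[k] C) :
    ∃ (D : Type u) (_ : CommRing D) (_ : Algebra k D) (i : B →ₐ[k] D) (j : C →ₐ[k] D),
      i.comp f = j.comp g ∧ (f.toRingHom.Flat → j.toRingHom.Flat) ∧
      ∀ (p : PrimeSpectrum B) (q : PrimeSpectrum C),
        PrimeSpectrum.comap f.toRingHom p = PrimeSpectrum.comap g.toRingHom q →
        ∃ r : PrimeSpectrum D, PrimeSpectrum.comap i.toRingHom r = p ∧
          PrimeSpectrum.comap j.toRingHom r = q := by
  let := f.toRingHom.toAlgebra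
  let := g.toRingHom.toAlgebra
  have : IsScalarTower k A B := IsScalarTower.of_algebraMap_eq' f.comp_algebraMap.symm
  have : IsScalarTower k A C := IsScalarTower.of_algebraMap_eq' g.comp_algebraMap.symm
  let i : B →ₐ[k] C ⊗[A] B :=
    (Algebra.TensorProduct.includeRight (R := A) (A := C) (B := B)).restrictScalars k
  let j : C →ₐ[k] C ⊗[A] B := Algebra.TensorProduct.includeLeft
  refine ⟨C ⊗[A] B, inferInstance, inferInstance, i, j, ?_, fun h => ?_, fun p q hpq => ?_⟩
  · ext a
    exact (Algebra.TensorProduct.includeRight (R := A) (A := C) (B := B)).commutes a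
  · have : Module.Flat A B := h
    have : Module.Flat C (C ⊗[A] B) := inferInstance
    exact RingHom.flat_algebraMap_iff.2 this
  · have hp : (PrimeSpectrum.comap f.toRingHom p).asIdeal = p.asIdeal.comap f.toRingHom := rfl
    have hq : (PrimeSpectrum.comap f.toRingHom p).asIdeal = q.asIdeal.comap g.toRingHom := by
      rw [hpq]; rfl
    obtain ⟨T, _, u, v, huv⟩ := exists_common_field_extension
      (Ideal.ResidueField.map _ p.asIdeal f.toRingHom hp)
      (Ideal.ResidueField.map _ q.asIdeal g.toRingHom hq)
    let u' := u.comp (algebraMap B p.asIdeal.ResidueField)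
    let v' := v.comp (algebraMap C q.asIdeal.ResidueField)
    have huv' : u'.comp f.toRingHom = v'.comp g.toRingHom := by
      ext a
      have := RingHom.congr_fun huv (algebraMap A _ a)
      rw [RingHom.comp_apply, RingHom.comp_apply, Ideal.ResidueField.map_algebraMap,
        Ideal.ResidueField.map_algebraMap] at this
      exact this
    let := (u'.comp f.toRingHom).toAlgebra
    let φ : C ⊗[A] B →ₐ[A] T := Algebra.TensorProduct.lift
      (⟨v', fun a => (RingHom.congr_fun huv' a).symm⟩ : C →ₐ[A] T)
      (⟨u', fun a => rfl⟩ : B →ₐ[A] T) (fun _ _ => Commute.all _ _)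
    -- The common point is the kernel of the map to the field `T`.
    refine ⟨PrimeSpectrum.comap φ.toRingHom ⊥, ?_, ?_⟩
    · ext b
      have : φ (i b) = u' b := by simp [φ, i]
      change φ (i b) = 0 ↔ _
      rw [this]
      simp [u']
    · ext c
      have : φ (j c) = v' c := by simp [φ, j]
      change φ (j c) = 0 ↔ _
      rw [this]
      simp [v']

end Pushout

/-! ### A flat cover with local components -/

section LocalCover

variable {k : Type u} [Field k] {A : Type u} [CommRing A] [Algebra k A]

variable (A) in
/-- Locally constant families of elements of a ring `A`, indexed by the prime ideals of `A`, none
of whose members lies in the corresponding prime. -/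
def nowhereVanishing : Submonoid (LocallyConstant (ConstructibleSpec A) A) where
  carrier := {h | ∀ x : ConstructibleSpec A, h x ∉ x.asIdeal}
  one_mem' x h := x.1.2.ne_top ((Ideal.eq_top_iff_one _).2 h)
  mul_mem' ha hb x h := (x.1.2.mem_or_mem h).elim (ha x) (hb x)

/-- Heuristically, the fibre of `B` over a point `x` of the constructible spectrum is the local ring
of `A` at `x`: such a family of local rings is flat, covers `Spec A`, and all primes over `x` are
generizations of `x`. The map `c` is the one classifying the `C(ConstructibleSpec A, k)`-algebra
structure of `B`. -/
theorem exists_flat_cover_components :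
    ∃ (B : Type u) (_ : CommRing B) (_ : Algebra k B) (φ : A →ₐ[k] B)
      (c : C(SpecComponents B, ConstructibleSpec A)),
      φ.toRingHom.Flat ∧ Function.Surjective (PrimeSpectrum.comap φ.toRingHom) ∧
      ∀ b, PrimeSpectrum.comap φ.toRingHom b ≤ (c (toSpecComponents b)).toPrimeSpectrum := by
  let T := LocallyConstant (ConstructibleSpec A) A
  let B := Localization (nowhereVanishing A)
  let φ : A →ₐ[k] B := (IsScalarTower.toAlgHom k T B).comp (LocallyConstant.constₐ k)
  let ψ : LocallyConstant (ConstructibleSpec A) k →ₐ[k] B :=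
    (IsScalarTower.toAlgHom k T B).comp (LocallyConstant.mapₐ k (Algebra.ofId k A))
  obtain ⟨c, hc⟩ := componentsHom_surjective ψ
  refine ⟨B, inferInstance, inferInstance, φ, c, ?_, fun p => ?_, fun b a ha => ?_⟩
  · have h1 : (LocallyConstant.constRingHom : A →+* T).Flat :=
      RingHom.flat_algebraMap_iff.2 (inferInstanceAs (Module.Flat A T))
    have h2 : (algebraMap T B).Flat :=
      RingHom.flat_algebraMap_iff.2 (IsLocalization.flat B (nowhereVanishing A))
    exact h1.comp h2
  -- Evaluation at `p` extends to a map from `B` to the local ring at `p`, and its maximal ideal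
  -- pulls back to a prime over `p`.
  · let ev : T →+* Localization.AtPrime p.asIdeal :=
      (algebraMap A _).comp (LocallyConstant.evalRingHom ⟨p⟩)
    have hev (y : nowhereVanishing A) : IsUnit (ev y) :=
      (isUnit_algebraMap_localization_iff p _).2 (y.2 ⟨p⟩)
    let q : PrimeSpectrum B := PrimeSpectrum.comap (IsLocalization.lift hev)
      ⟨IsLocalRing.maximalIdeal (Localization.AtPrime p.asIdeal), inferInstance⟩
    refine ⟨q, ?_⟩
    ext a
    change IsLocalization.lift hev (algebraMap T B (LocallyConstant.const _ a)) ∈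
      IsLocalRing.maximalIdeal (Localization.AtPrime p.asIdeal) ↔ a ∈ p.asIdeal
    rw [IsLocalization.lift_eq, IsLocalRing.mem_maximalIdeal, mem_nonunits_iff, not_iff_comm,
      ← isUnit_algebraMap_localization_iff]
    rfl
  · by_contra hax
    let f : LocallyConstant (ConstructibleSpec A) k :=
      LocallyConstant.charFn k (isClopen_setOf_mem_asIdeal a)
    have hf : ψ f ∈ b.asIdeal := by
      rw [← hc, componentsHom_mem_iff]
      exact Set.indicator_of_notMem (s := {p | a ∈ ConstructibleSpec.asIdeal p}) hax 1
    -- Adding the indicator of `{x | a ∈ x}` to the constant `a` gives `a + 1` where `a ∈ x` and `a`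
    -- elsewhere, so `t` becomes a unit in `B`. Yet both summands lie in `b`.
    let t : T := LocallyConstant.const _ a + LocallyConstant.mapₐ k (Algebra.ofId k A) f
    have ht : t ∈ nowhereVanishing A := by
      intro x hx
      by_cases hax : a ∈ x.asIdeal
      · have h1 : f x = 1 := Set.indicator_of_mem (s := {p | a ∈ ConstructibleSpec.asIdeal p}) hax 1
        have h2 : t x = a + 1 := by
          change a + algebraMap k A (f x) = a + 1
          rw [h1, map_one]
        rw [h2] at hx
        exact x.1.2.ne_top ((Ideal.eq_top_iff_one _).2 ((Ideal.add_mem_iff_right _ hax).1 hx))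
      · have h1 : f x = 0 :=
          Set.indicator_of_notMem (s := {p | a ∈ ConstructibleSpec.asIdeal p}) hax 1
        have h2 : t x = a := by
          change a + algebraMap k A (f x) = a
          rw [h1, map_zero, add_zero]
        rw [h2] at hx
        exact hax hx
    refine b.2.ne_top (b.asIdeal.eq_top_of_isUnit_mem ?_
      (IsLocalization.map_units B (⟨t, ht⟩ : nowhereVanishing A)))
    change algebraMap T B (_ + _) ∈ b.asIdeal
    rw [map_add]
    exact b.asIdeal.add_mem ha hf

end LocalCover


/-! ### The spectrum functors -/

section Functors

variable (k : Type u) [Field k]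

/-- The prime spectrum with the constructible topology, as a functor from affine schemes to
profinite sets. -/
noncomputable def constructibleSpec : (CommAlgCat.{u} k)ᵒᵖ ⥤ Profinite.{u} where
  obj A := Profinite.of (ConstructibleSpec A.unop)
  map f := CompHausLike.ofHom _ ⟨ConstructibleSpec.comap f.unop.hom.toRingHom,
    ConstructibleSpec.continuous_comap _⟩
  map_id _ := rfl
  map_comp _ _ := rfl

/-- Pairs of comparable primes, as a functor from affine schemes to profinite sets. -/
noncomputable def specializationPairs : (CommAlgCat.{u} k)ᵒᵖ ⥤ Profinite.{u} where
  obj A := Profinite.of (SpecializationPairs A.unop)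
  map f := CompHausLike.ofHom _
    ⟨fun x => ⟨(ConstructibleSpec.comap f.unop.hom.toRingHom x.1.1,
      ConstructibleSpec.comap f.unop.hom.toRingHom x.1.2),
        ConstructibleSpec.comap_mono _ x.2⟩,
      (((ConstructibleSpec.continuous_comap _).comp
        (continuous_fst.comp continuous_subtype_val)).prodMk
          ((ConstructibleSpec.continuous_comap _).comp
            (continuous_snd.comp continuous_subtype_val))).subtype_mk _⟩
  map_id _ := rfl
  map_comp _ _ := rfl

/-- The space of components of the spectrum, as a functor from affine schemes to
profinite sets. -/
noncomputable def specComponents : (CommAlgCat.{u} k)ᵒᵖ ⥤ Profinite.{u} where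
  obj A := Profinite.of (SpecComponents A.unop)
  map f := CompHausLike.ofHom _ ⟨SpecComponents.comap f.unop.hom.toRingHom,
    SpecComponents.continuous_comap _⟩
  map_id _ := rfl
  map_comp _ _ := rfl

/-- The smaller prime of a pair. -/
noncomputable def pairFst : specializationPairs k ⟶ constructibleSpec k where
  app _ := CompHausLike.ofHom _ ⟨fun x => x.1.1, continuous_fst.comp continuous_subtype_val⟩
  naturality _ _ _ := rfl

/-- The larger prime of a pair. -/
noncomputable def pairSnd : specializationPairs k ⟶ constructibleSpec k where
  app _ := CompHausLike.ofHom _ ⟨fun x => x.1.2, continuous_snd.comp continuous_subtype_val⟩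
  naturality _ _ _ := rfl

lemma continuous_constructibleSpec_toSpecComponents {A : Type u} [CommRing A] :
    Continuous fun x : ConstructibleSpec A => toSpecComponents x.toPrimeSpectrum := by
  refine Continuous.subtype_mk (continuous_pi fun e => ?_) _
  rw [continuous_bool_rng true]
  convert isClopen_setOf_mem_asIdeal e.1 using 1
  ext p
  exact idempotentIndicator_eq_true

/-- The projection from the constructible spectrum to the space of components. -/
noncomputable def constructibleSpecToComponents : constructibleSpec k ⟶ specComponents k where
  app _ := CompHausLike.ofHom _ ⟨fun x => toSpecComponents x.toPrimeSpectrum,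
    continuous_constructibleSpec_toSpecComponents⟩
  naturality _ _ _ := rfl

lemma pair_comp_constructibleSpecToComponents :
    pairFst k ≫ constructibleSpecToComponents k = pairSnd k ≫ constructibleSpecToComponents k := by
  ext A x
  exact toSpecComponents_eq_of_le x.2

/-- Maps from the space of components to a profinite set are maps of affine schemes to the
spectrum of its algebra of continuous functions. -/
noncomputable def componentsHomEquiv (A : (CommAlgCat.{u} k)ᵒᵖ) (S : Profinite.{u}) :
    ((specComponents k).obj A ⟶ S) ≃ (A ⟶ (continuousFunctions k).obj S) :=
  Equiv.ofBijective (fun h => (CommAlgCat.ofHom (componentsHom (k := k) h.hom.hom)).op) <| by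
    constructor
    · intro h₁ h₂ h
      have := componentsHom_injective (congrArg (fun g => g.unop.hom) h)
      ext x
      exact DFunLike.congr_fun this x
    · intro ψ
      obtain ⟨h, hh⟩ := componentsHom_surjective ψ.unop.hom
      refine ⟨CompHausLike.ofHom _ h, Quiver.Hom.unop_inj (CommAlgCat.hom_ext hh)⟩

/-- Compared germwise, through the local homomorphism from the localization of `A` at the preimage
of `p` to that of `B` at `p`. -/
lemma componentsHom_comp {A B S : Type u} [CommRing A] [CommRing B] [Algebra k A] [Algebra k B]
    [TopologicalSpace S] (f : A →ₐ[k] B) (h : C(SpecComponents A, S)) :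
    f.comp (componentsHom h) = componentsHom (h.comp ⟨SpecComponents.comap f.toRingHom,
      SpecComponents.continuous_comap _⟩) := by
  ext g
  have key (p : PrimeSpectrum B) :
      algebraMap A (Localization.AtPrime (PrimeSpectrum.comap f.toRingHom p).asIdeal)
        (componentsHom h g) = algebraMap A _ (algebraMap k A
          (g (h (toSpecComponents (PrimeSpectrum.comap f.toRingHom p))))) :=
    algebraMap_globalSection _ (PrimeSpectrum.comap f.toRingHom p)
  refine eq_of_forall_localization fun p => ?_
  refine Eq.trans ?_ (algebraMap_globalSection _ p).symm
  have h2 := (Localization.localRingHom_to_map _ p.asIdeal f.toRingHom rfl _).symm.trans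
    ((congrArg (Localization.localRingHom _ p.asIdeal f.toRingHom rfl) (key p)).trans
      (Localization.localRingHom_to_map _ p.asIdeal f.toRingHom rfl _))
  refine h2.trans (congrArg _ ?_)
  exact f.commutes _

/-- The space of components is left adjoint to the functor of continuous functions. -/
noncomputable def componentsAdjunction : specComponents k ⊣ continuousFunctions k :=
  Adjunction.mkOfHomEquiv
    { homEquiv := componentsHomEquiv k
      homEquiv_naturality_left_symm := fun {A B S} f g => by
        obtain ⟨h, rfl⟩ := (componentsHomEquiv k B S).surjective g
        rw [Equiv.symm_apply_eq, Equiv.symm_apply_apply]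
        exact Quiver.Hom.unop_inj (CommAlgCat.hom_ext (componentsHom_comp k f.unop.hom h.hom.hom))
      homEquiv_naturality_right := fun _ _ => rfl }

instance : (continuousFunctions k).IsRightAdjoint :=
  ⟨_, ⟨componentsAdjunction k⟩⟩

end Functors

/-! ### Spectra of filtered colimits of algebras -/

section FilteredColimits

variable (k : Type u) [Field k]

instance : PreservesFilteredColimits (forget (CommAlgCat.{u} k)) where
  preserves_filtered_colimits _ _ _ :=
    preservesColimitsOfShape_of_natIso
      (F := (commAlgCatEquivUnder (.of k)).functor ⋙ Under.forget _ ⋙ forget CommRingCat.{u})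
      (Iso.refl _)

variable {k} {I : Type u} [SmallCategory I] {K : I ⥤ (CommAlgCat.{u} k)ᵒᵖ}
  {c : Cone K}

lemma π_unop_apply {i j : I} (f : i ⟶ j) (b : (K.obj j).unop) :
    (c.π.app i).unop ((K.map f).unop b) = (c.π.app j).unop b := by
  rw [← CommAlgCat.comp_apply, ← unop_comp, c.w]

variable [IsCofiltered I]

lemma exists_rep_of_isLimit (hc : IsLimit c) (a : c.pt.unop) : ∃ (i : I) (b : (K.obj i).unop),
    (c.π.app i).unop b = a := by
  have h := isColimitOfPreserves (forget (CommAlgCat.{u} k)) (isColimitCoconeLeftOpOfCone K hc)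
  obtain ⟨i, b, hb⟩ := Types.jointly_surjective_of_isColimit h a
  exact ⟨i.unop, b, hb⟩

lemma exists_eq_of_isLimit (hc : IsLimit c) {i j : I} (a : (K.obj i).unop) (b : (K.obj j).unop)
    (h : (c.π.app i).unop a = (c.π.app j).unop b) :
    ∃ (l : I) (f : l ⟶ i) (g : l ⟶ j), (K.map f).unop a = (K.map g).unop b := by
  have hc' := isColimitOfPreserves (forget (CommAlgCat.{u} k)) (isColimitCoconeLeftOpOfCone K hc)
  obtain ⟨l, f, g, hfg⟩ := (Types.FilteredColimit.isColimit_eq_iff _ hc' (i := op i) (j := op j)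
    (xi := a) (xj := b)).1 h
  exact ⟨l.unop, f.unop, g.unop, hfg⟩

/-- Compatible families of primes in a filtered diagram of algebras come from primes of the
colimit. -/
lemma existsUnique_prime_of_isLimit (hc : IsLimit c) (p : ∀ i, ConstructibleSpec (K.obj i).unop)
    (hp : ∀ ⦃i j⦄ (f : i ⟶ j),
      ConstructibleSpec.comap (K.map f).unop.hom.toRingHom (p i) = p j) :
    ∃! x : ConstructibleSpec c.pt.unop,
      ∀ i, ConstructibleSpec.comap (c.π.app i).unop.hom.toRingHom x = p i := by
  have hp' {i j} (f : i ⟶ j) (a : (K.obj j).unop) :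
      (K.map f).unop a ∈ (p i).asIdeal ↔ a ∈ (p j).asIdeal := by
    rw [← hp f]
    rfl
  -- Membership does not depend on the representative, since two representatives of one element
  -- agree at a later stage.
  have hmem {i j} (a : (K.obj i).unop) (b : (K.obj j).unop)
      (h : (c.π.app i).unop a = (c.π.app j).unop b) : a ∈ (p i).asIdeal ↔ b ∈ (p j).asIdeal := by
    obtain ⟨l, f, g, hfg⟩ := exists_eq_of_isLimit hc a b h
    rw [← hp' f, ← hp' g, hfg]
  have hpair (x y : c.pt.unop) : ∃ (l : I) (a b : (K.obj l).unop),
      (c.π.app l).unop a = x ∧ (c.π.app l).unop b = y := by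
    obtain ⟨i, a, rfl⟩ := exists_rep_of_isLimit hc x
    obtain ⟨j, b, rfl⟩ := exists_rep_of_isLimit hc y
    exact ⟨IsCofiltered.min i j, (K.map (IsCofiltered.minToLeft i j)).unop a,
      (K.map (IsCofiltered.minToRight i j)).unop b, π_unop_apply _ _, π_unop_apply _ _⟩
  let P : Ideal c.pt.unop :=
    { carrier := {x | ∃ (i : I) (a : (K.obj i).unop), a ∈ (p i).asIdeal ∧ (c.π.app i).unop a = x}
      add_mem' := by
        rintro x y ⟨i, a, ha, hax⟩ ⟨j, b, hb, hby⟩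
        obtain ⟨l, a', b', rfl, rfl⟩ := hpair x y
        exact ⟨l, a' + b', (p l).asIdeal.add_mem ((hmem _ _ hax).1 ha) ((hmem _ _ hby).1 hb),
          map_add _ _ _⟩
      zero_mem' := ⟨IsCofiltered.nonempty.some, 0, Ideal.zero_mem _, map_zero _⟩
      smul_mem' := by
        rintro y x ⟨i, a, ha, hax⟩
        obtain ⟨l, a', b', rfl, rfl⟩ := hpair x y
        exact ⟨l, b' * a', (p l).asIdeal.mul_mem_left _ ((hmem _ _ hax).1 ha), map_mul _ _ _⟩ }
  have hP (i : I) (a : (K.obj i).unop) : (c.π.app i).unop a ∈ P ↔ a ∈ (p i).asIdeal := by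
    refine ⟨?_, fun h => ⟨i, a, h, rfl⟩⟩
    rintro ⟨j, b, hb, hba⟩
    exact (hmem _ _ hba).1 hb
  have hPprime : P.IsPrime := by
    refine ⟨fun h => ?_, fun {x y} hxy => ?_⟩
    · have h1 : (1 : c.pt.unop) ∈ P := h ▸ Submodule.mem_top
      have i := IsCofiltered.nonempty (C := I).some
      rw [← map_one (c.π.app i).unop.hom] at h1
      exact (p i).1.2.ne_top ((Ideal.eq_top_iff_one _).2 ((hP i 1).1 h1))
    · obtain ⟨l, a, b, rfl, rfl⟩ := hpair x y
      rw [hP, hP]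
      rw [← map_mul (c.π.app l).unop.hom] at hxy
      exact (p l).1.2.mem_or_mem ((hP l (a * b)).1 hxy)
  refine ⟨⟨⟨P, hPprime⟩⟩, fun i => ?_, fun y hy => ?_⟩
  · ext a
    exact hP i a
  · ext x
    obtain ⟨i, a, rfl⟩ := exists_rep_of_isLimit hc x
    refine Iff.trans ?_ (hP i a).symm
    rw [← hy i]
    rfl

variable (k I)

/-- A continuous bijection of profinite sets is an isomorphism, so limits can be checked on points.
-/
instance : PreservesLimitsOfShape I (constructibleSpec k) := by
  have := reflectsLimitsOfShape_of_reflectsIsomorphisms (G := forget Profinite.{u}) (J := I)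
  refine ⟨fun {K} => ⟨fun {c} hc => ⟨isLimitOfReflects (forget Profinite) (Nonempty.some ?_)⟩⟩⟩
  rw [Types.isLimit_iff]
  intro s hs
  exact existsUnique_prime_of_isLimit hc s fun i j f => hs f

instance : PreservesLimitsOfShape I (specializationPairs k) := by
  have := reflectsLimitsOfShape_of_reflectsIsomorphisms (G := forget Profinite.{u}) (J := I)
  refine ⟨fun {K} => ⟨fun {c} hc => ⟨isLimitOfReflects (forget Profinite) (Nonempty.some ?_)⟩⟩⟩
  rw [Types.isLimit_iff]
  intro s hs
  let t (i : I) : SpecializationPairs (K.obj i).unop := s i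
  have ht {i j : I} (f : i ⟶ j) : (specializationPairs k).map (K.map f) (t i) = t j := hs f
  obtain ⟨x, hx, hx'⟩ := existsUnique_prime_of_isLimit hc (fun i => (t i).1.1)
    fun i j f => congrArg (fun z => z.1.1) (ht f)
  obtain ⟨y, hy, hy'⟩ := existsUnique_prime_of_isLimit hc (fun i => (t i).1.2)
    fun i j f => congrArg (fun z => z.1.2) (ht f)
  have hxy : x ≤ y := by
    rw [ConstructibleSpec.le_iff]
    intro a ha
    obtain ⟨i, b, rfl⟩ := exists_rep_of_isLimit hc a
    have h1 : b ∈ (t i).1.1.asIdeal := by rw [← hx i]; exact ha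
    have h2 : b ∈ (t i).1.2.asIdeal := (t i).2 h1
    rw [← hy i] at h2
    exact h2
  refine ⟨(⟨(x, y), hxy⟩ : SpecializationPairs c.pt.unop), fun i => ?_, fun z hz => ?_⟩
  · exact Subtype.ext (Prod.ext (hx i) (hy i))
  · let z' : SpecializationPairs c.pt.unop := z
    have hz' (i : I) : (specializationPairs k).map (c.π.app i) z' = t i := hz i
    have h1 : z'.1.1 = x := hx' _ fun i => congrArg (fun z => z.1.1) (hz' i)
    have h2 : z'.1.2 = y := hy' _ fun i => congrArg (fun z => z.1.2) (hz' i)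
    exact Subtype.ext (Prod.ext h1 h2)

end FilteredColimits


/-! ### Gluing sections of sheaves on profinite sets -/

section Gluing

lemma map_op_map_op {C : Type*} [Category* C] (X : Cᵒᵖ ⥤ Type u) {U V W : C} (f : U ⟶ V)
    (g : V ⟶ W) (s : X.obj (op W)) :
    X.map f.op (X.map g.op s) = X.map (f ≫ g).op s := by
  rw [op_comp, X.map_comp]
  rfl

variable {X : Profinite.{u}ᵒᵖ ⥤ Type u}

lemma isSheafFor_of_jointly_surjective
    (hX : Presieve.IsSheaf (coherentTopology Profinite.{u}) X)
    {α : Type} [Finite α] {S : Profinite.{u}}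
    (Y : α → Profinite.{u}) (f : ∀ a, Y a ⟶ S) (hf : ∀ s : S, ∃ a, ∃ y : Y a, f a y = s) :
    Presieve.IsSheafFor X (Presieve.ofArrows Y f) := by
  rw [Presieve.isSheafFor_iff_generate]
  refine hX _ (coherentTopology.mem_sieves_of_hasEffectiveEpiFamily _
    ⟨α, inferInstance, Y, f, Profinite.effectiveEpiFamily_of_jointly_surjective Y f hf,
      fun a => Sieve.le_generate _ _ _ (Presieve.ofArrows.mk a)⟩)

lemma eq_of_jointly_surjective
    (hX : Presieve.IsSheaf (coherentTopology Profinite.{u}) X)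
    {α : Type} [Finite α] {S : Profinite.{u}}
    (Y : α → Profinite.{u}) (f : ∀ a, Y a ⟶ S) (hf : ∀ s : S, ∃ a, ∃ y : Y a, f a y = s)
    {s t : X.obj (op S)} (h : ∀ a, X.map (f a).op s = X.map (f a).op t) : s = t := by
  refine (isSheafFor_of_jointly_surjective hX Y f hf).isSeparatedFor.ext ?_
  rintro _ _ ⟨a⟩
  exact h a

lemma map_injective_of_surjective
    (hX : Presieve.IsSheaf (coherentTopology Profinite.{u}) X) {S T : Profinite.{u}} (f : T ⟶ S)
    (hf : Function.Surjective f) : Function.Injective (X.map f.op) := fun _ _ h =>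
  eq_of_jointly_surjective hX (fun _ : Unit => T) (fun _ => f)
    (fun s => ⟨(), hf s⟩) (fun _ => h)

/-- Sections on the members of a finite jointly surjective family glue, provided that they agree
on profinite sets covering the fibre products of the members. -/
lemma exists_glue_of_jointly_surjective
    (hX : Presieve.IsSheaf (coherentTopology Profinite.{u}) X)
    {α : Type} [Finite α] {S : Profinite.{u}}
    (Y : α → Profinite.{u}) (f : ∀ a, Y a ⟶ S) (hf : ∀ s : S, ∃ a, ∃ y : Y a, f a y = s)
    (x : ∀ a, X.obj (op (Y a)))
    (h : ∀ a b, ∃ (Z : Profinite.{u}) (g₁ : Z ⟶ Y a) (g₂ : Z ⟶ Y b),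
      X.map g₁.op (x a) = X.map g₂.op (x b) ∧
        ∀ (y : Y a) (y' : Y b), f a y = f b y' → ∃ z, g₁ z = y ∧ g₂ z = y') :
    ∃ t : X.obj (op S), ∀ a, X.map (f a).op t = x a := by
  refine ((Presieve.isSheafFor_arrows_iff _ _).1
    (isSheafFor_of_jointly_surjective hX Y f hf) x ?_).exists
  intro a b W h₁ h₂ hW
  obtain ⟨Z, g₁, g₂, hg, hZ⟩ := h a b
  -- Compatibility over `W` is checked on the fibre product of `W` and `Z` over `Y a × Y b`, which
  -- surjects onto `W` by the hypothesis on `Z`.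
  have hclosed : IsClosed {p : W × Z | h₁ p.1 = g₁ p.2 ∧ h₂ p.1 = g₂ p.2} :=
    (isClosed_eq (h₁.hom.hom.continuous.comp continuous_fst)
      (g₁.hom.hom.continuous.comp continuous_snd)).inter
    (isClosed_eq (h₂.hom.hom.continuous.comp continuous_fst)
      (g₂.hom.hom.continuous.comp continuous_snd))
  have : CompactSpace {p : W × Z | h₁ p.1 = g₁ p.2 ∧ h₂ p.1 = g₂ p.2} :=
    isCompact_iff_compactSpace.1 hclosed.isCompact
  let P : Profinite.{u} := Profinite.of {p : W × Z | h₁ p.1 = g₁ p.2 ∧ h₂ p.1 = g₂ p.2}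
  let q₁ : P ⟶ W := CompHausLike.ofHom _ ⟨fun p => p.1.1, continuous_fst.comp continuous_subtype_val⟩
  let q₂ : P ⟶ Z := CompHausLike.ofHom _ ⟨fun p => p.1.2, continuous_snd.comp continuous_subtype_val⟩
  have hq₁ : q₁ ≫ h₁ = q₂ ≫ g₁ := by
    ext p
    exact p.2.1
  have hq₂ : q₁ ≫ h₂ = q₂ ≫ g₂ := by
    ext p
    exact p.2.2
  have hsurj : Function.Surjective q₁ := by
    intro w
    have hw : f a (h₁ w) = f b (h₂ w) := ConcreteCategory.congr_hom hW w
    obtain ⟨z, hz₁, hz₂⟩ := hZ _ _ hw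
    exact ⟨⟨(w, z), hz₁.symm, hz₂.symm⟩, rfl⟩
  apply map_injective_of_surjective hX q₁ hsurj
  rw [map_op_map_op, map_op_map_op, hq₁, hq₂, ← map_op_map_op, hg, map_op_map_op]

end Gluing

/-! ### The fpqc topology -/

section Fpqc

variable (k : Type u) [CommRing k]

/-- The fpqc coverings as a coverage. -/
def fpqcCoverage : Coverage (CommAlgCat.{u} k)ᵒᵖ where
  toPrecoverage := fpqcPrecoverage k
  pullback := by
    rintro X Y g _ ⟨n, B, f, hflat, hsurj, rfl⟩
    choose D _ _ i j hij hD hr using fun a => exists_pushout (f a).hom g.unop.hom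
    refine ⟨Presieve.ofArrows (fun a => op (CommAlgCat.of k (D a)))
      (fun a => (CommAlgCat.ofHom (j a)).op), ⟨n, _, fun a => CommAlgCat.ofHom (j a),
        fun a => hD a (hflat a), fun q => ?_, rfl⟩, ?_⟩
    · obtain ⟨a, p, hp⟩ := hsurj (PrimeSpectrum.comap g.unop.hom.toRingHom q)
      obtain ⟨r, -, hr⟩ := hr a p q hp
      exact ⟨a, r, hr⟩
    · rintro _ _ ⟨a⟩
      refine ⟨_, (CommAlgCat.ofHom (i a)).op, (f a).op, ⟨a⟩, ?_⟩
      exact Quiver.Hom.unop_inj (CommAlgCat.hom_ext (hij a))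

lemma isSheaf_fpqcTopology_iff (P : (CommAlgCat.{u} k)ᵒᵖᵒᵖ ⥤ Type u) :
    Presieve.IsSheaf (fpqcTopology k) P ↔
      ∀ ⦃X : (CommAlgCat.{u} k)ᵒᵖ⦄ (R : Presieve X), R ∈ fpqcPrecoverage k X →
        Presieve.IsSheafFor P R := by
  have : fpqcTopology k = (fpqcCoverage k).toGrothendieck :=
    Coverage.toGrothendieck_toPrecoverage (fpqcCoverage k)
  rw [this, Presieve.isSheaf_coverage]
  rfl

end Fpqc

/-! ### The pullback of a condensed set -/

section ComparableSections

variable (k : Type u) [Field k]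

/-- The sections of a presheaf on profinite sets over the constructible spectrum of an algebra
whose values at comparable primes agree. -/
noncomputable def comparableSectionsObj (X : Profinite.{u}ᵒᵖ ⥤ Type u) :
    (CommAlgCat.{u} k)ᵒᵖᵒᵖ ⥤ Type u where
  obj A := {s : X.obj (op ((constructibleSpec k).obj A.unop)) //
    X.map ((pairFst k).app A.unop).op s = X.map ((pairSnd k).app A.unop).op s}
  map f := ↾fun s => ⟨X.map ((constructibleSpec k).map f.unop).op s.1, by
    rw [map_op_map_op, map_op_map_op, ← (pairFst k).naturality, ← (pairSnd k).naturality,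
      ← map_op_map_op, s.2, map_op_map_op]⟩
  map_id A := by
    ext s
    change X.map ((constructibleSpec k).map (𝟙 A.unop)).op s.1 = s.1
    rw [CategoryTheory.Functor.map_id, op_id, X.map_id]
    rfl
  map_comp f g := by
    ext s
    change X.map ((constructibleSpec k).map (g.unop ≫ f.unop)).op s.1 = X.map _ (X.map _ s.1)
    rw [map_op_map_op, Functor.map_comp]

/-- The functor sending a presheaf on profinite sets to its presheaf of sections over constructible
spectra agreeing at comparable primes. -/
noncomputable def comparableSections :
    (Profinite.{u}ᵒᵖ ⥤ Type u) ⥤ ((CommAlgCat.{u} k)ᵒᵖᵒᵖ ⥤ Type u) where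
  obj := comparableSectionsObj k
  map φ :=
    { app A := ↾fun s => ⟨φ.app _ s.1, by
        rw [← NatTrans.naturality_apply, ← NatTrans.naturality_apply, s.2]⟩
      naturality A B f := by
        ext s
        exact Subtype.ext (NatTrans.naturality_apply φ _ _) }
  map_id _ := rfl
  map_comp _ _ := rfl

/-- Sections over the space of components as sections over the constructible spectrum. -/
noncomputable def componentSections :
    (Functor.whiskeringLeft _ _ (Type u)).obj (specComponents k).op ⟶ comparableSections k where
  app X :=
    { app A := ↾fun s => ⟨X.map ((constructibleSpecToComponents k).app A.unop).op s, by
        rw [map_op_map_op, map_op_map_op, ← NatTrans.comp_app, ← NatTrans.comp_app,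
          pair_comp_constructibleSpecToComponents]⟩
      naturality A B f := by
        ext s
        refine Subtype.ext ?_
        change X.map ((constructibleSpecToComponents k).app B.unop).op
          (X.map ((specComponents k).map f.unop).op s) =
          X.map ((constructibleSpec k).map f.unop).op
            (X.map ((constructibleSpecToComponents k).app A.unop).op s)
        rw [map_op_map_op, map_op_map_op, NatTrans.naturality] }
  naturality X Y φ := by
    ext A s
    exact Subtype.ext (NatTrans.naturality_apply φ _ _).symm

variable {k} {X : Profinite.{u}ᵒᵖ ⥤ Type u}

lemma componentSections_injective (hX : Presieve.IsSheaf (coherentTopology Profinite.{u}) X)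
    (A : (CommAlgCat.{u} k)ᵒᵖᵒᵖ) : Function.Injective (((componentSections k).app X).app A) := by
  intro s t h
  refine map_injective_of_surjective hX ((constructibleSpecToComponents k).app A.unop) ?_
    (congrArg Subtype.val h)
  intro y
  obtain ⟨p, rfl⟩ := toSpecComponents_surjective y
  exact ⟨⟨p⟩, rfl⟩

/-- An fpqc cover is jointly surjective on constructible spectra, so sections glue uniquely.
Flatness enters only through going-down: comparable pairs lift to the cover, so comparability of the
glued section can be tested there. -/
lemma isSheaf_comparableSections (hX : Presieve.IsSheaf (coherentTopology Profinite.{u}) X) :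
    Presieve.IsSheaf (fpqcTopology k) ((comparableSections k).obj X) := by
  rw [isSheaf_fpqcTopology_iff]
  rintro A _ ⟨n, B, f, hflat, hsurj, rfl⟩
  rw [Presieve.isSheafFor_arrows_iff]
  intro x hx
  have hf (p : (constructibleSpec k).obj A) :
      ∃ a, ∃ q : (constructibleSpec k).obj (op (B a)), (constructibleSpec k).map (f a).op q = p := by
    obtain ⟨a, q, hq⟩ := hsurj (ConstructibleSpec.toPrimeSpectrum p)
    exact ⟨a, ⟨q⟩, ConstructibleSpec.toPrimeSpectrum_injective hq⟩
  refine existsUnique_of_exists_of_unique ?_ ?_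
  · obtain ⟨t, ht⟩ := exists_glue_of_jointly_surjective hX _
      (fun a => (constructibleSpec k).map (f a).op) hf (fun a => (x a).1) fun a b => by
        obtain ⟨D, _, _, i, j, hij, -, hr⟩ := exists_pushout (f a).hom (f b).hom
        refine ⟨(constructibleSpec k).obj (op (CommAlgCat.of k D)),
          (constructibleSpec k).map (CommAlgCat.ofHom i).op,
          (constructibleSpec k).map (CommAlgCat.ofHom j).op, ?_, fun p q hpq => ?_⟩
        · exact congrArg Subtype.val (hx a b _ (CommAlgCat.ofHom i).op (CommAlgCat.ofHom j).op
            (Quiver.Hom.unop_inj (CommAlgCat.hom_ext hij)))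
        · obtain ⟨r, hr₁, hr₂⟩ := hr (ConstructibleSpec.toPrimeSpectrum p)
            (ConstructibleSpec.toPrimeSpectrum q)
            (congrArg ConstructibleSpec.toPrimeSpectrum hpq)
          exact ⟨⟨r⟩, ConstructibleSpec.toPrimeSpectrum_injective hr₁,
            ConstructibleSpec.toPrimeSpectrum_injective hr₂⟩
    refine ⟨⟨t, ?_⟩, fun a => Subtype.ext (ht a)⟩
    refine eq_of_jointly_surjective hX _ (fun a => (specializationPairs k).map (f a).op) ?_
      fun a => ?_
    · intro z
      obtain ⟨⟨⟨p⟩, ⟨q⟩⟩, (hpq : p ≤ q)⟩ : SpecializationPairs A.unop := z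
      obtain ⟨a, q', rfl⟩ := hsurj q
      obtain ⟨p', hp'q', hp'⟩ := (hflat a).generalizingMap_comap
        ((PrimeSpectrum.le_iff_specializes _ _).1 hpq)
      refine ⟨a, (⟨(⟨p'⟩, ⟨q'⟩), (PrimeSpectrum.le_iff_specializes _ _).2 hp'q'⟩ :
        SpecializationPairs (B a)), ?_⟩
      exact Subtype.ext (Prod.ext (ConstructibleSpec.toPrimeSpectrum_injective hp') rfl)
    · rw [map_op_map_op, map_op_map_op, NatTrans.naturality, NatTrans.naturality,
        ← map_op_map_op, ← map_op_map_op]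
      have h1 : X.map ((constructibleSpec k).map (f a).op).op t = (x a).1 := ht a
      rw [h1]
      exact (x a).2
  · intro s t hs ht
    refine Subtype.ext (eq_of_jointly_surjective hX _
      (fun a => (constructibleSpec k).map (f a).op) hf fun a => ?_)
    exact congrArg Subtype.val ((hs a).trans (ht a).symm)

/-- Every section agreeing at comparable primes comes fpqc locally from the space of components. -/
lemma componentSections_locally_surjective (A : (CommAlgCat.{u} k)ᵒᵖ)
    (s : ((comparableSections k).obj X).obj (op A)) :
    ∃ S ∈ fpqcTopology k A, ∀ ⦃B : (CommAlgCat.{u} k)ᵒᵖ⦄ (f : B ⟶ A), S f →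
      ∃ r, ((componentSections k).app X).app (op B) r =
        ((comparableSections k).obj X).map f.op s := by
  obtain ⟨B, _, _, φ, c, hflat, hsurj, hc⟩ := exists_flat_cover_components (k := k) (A := A.unop)
  let φ' : op (CommAlgCat.of k B) ⟶ A := (CommAlgCat.ofHom φ).op
  have hmem : Presieve.ofArrows (fun _ : Fin 1 => op (CommAlgCat.of k B)) (fun _ => φ') ∈
      fpqcPrecoverage k A :=
    ⟨1, fun _ => CommAlgCat.of k B, fun _ => CommAlgCat.ofHom φ, fun _ => hflat,
      fun p => ⟨0, hsurj p⟩, rfl⟩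
  refine ⟨_, Precoverage.generate_mem_toGrothendieck hmem, ?_⟩
  let c' : (specComponents k).obj (op (CommAlgCat.of k B)) ⟶ (constructibleSpec k).obj A :=
    CompHausLike.ofHom _ c
  -- Each `b` gives the comparable pair of its image in `Spec A` and the point `c` of its component.
  -- By comparability of `s`, its restriction to `B` is its pullback along `c`, which factors
  -- through the components.
  have hcont : Continuous fun b : ConstructibleSpec B =>
      (⟨(ConstructibleSpec.comap φ.toRingHom b, c (toSpecComponents b.toPrimeSpectrum)),
        hc b.toPrimeSpectrum⟩ : SpecializationPairs A.unop) :=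
    ((ConstructibleSpec.continuous_comap _).prodMk
      (c.continuous.comp continuous_constructibleSpec_toSpecComponents)).subtype_mk _
  let h : (constructibleSpec k).obj (op (CommAlgCat.of k B)) ⟶ (specializationPairs k).obj A :=
    CompHausLike.ofHom _ ⟨_, hcont⟩
  have h₁ : h ≫ (pairFst k).app A = (constructibleSpec k).map φ' := rfl
  have h₂ : h ≫ (pairSnd k).app A =
    (constructibleSpecToComponents k).app (op (CommAlgCat.of k B)) ≫ c' := rfl
  have key : ((componentSections k).app X).app (op (op (CommAlgCat.of k B))) (X.map c'.op s.1) =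
      ((comparableSections k).obj X).map φ'.op s := by
    refine Subtype.ext ?_
    change X.map ((constructibleSpecToComponents k).app (op (CommAlgCat.of k B))).op
      (X.map c'.op s.1) = X.map ((constructibleSpec k).map φ').op s.1
    rw [map_op_map_op, ← h₁, ← h₂, ← map_op_map_op, ← map_op_map_op]
    exact congrArg _ s.2.symm
  rintro C f ⟨_, g, _, ⟨⟩, rfl⟩
  refine ⟨X.map ((specComponents k).map g).op (X.map c'.op s.1), ?_⟩
  refine (NatTrans.naturality_apply ((componentSections k).app X) g.op (X.map c'.op s.1)).trans ?_
  rw [key, map_op_map_op]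

/-- The presheaf is an equalizer of two presheaves obtained from `X` by precomposition with functors
that preserve cofiltered limits, and equalizers commute with filtered colimits of sets. -/
lemma isCardinalAccessible_comparableSections (κ : Cardinal.{u}) [Fact κ.IsRegular]
    [X.IsCardinalAccessible κ] :
    ((comparableSections k).obj X).IsCardinalAccessible κ where
  preservesColimitOfShape J _ _ := by
    have := isFiltered_of_isCardinalFiltered J κ
    have := X.preservesColimitsOfShape_of_isCardinalAccessible κ J
    have := preservesColimitsOfShape_op J (constructibleSpec k)
    have := preservesColimitsOfShape_op J (specializationPairs k)
    refine ⟨fun {K} => ⟨fun {c} hc => ⟨Types.FilteredColimit.isColimitOf' _ _ ?_ ?_⟩⟩⟩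
    · intro s
      have h₁ := isColimitOfPreserves ((constructibleSpec k).op ⋙ X) hc
      have h₂ := isColimitOfPreserves ((specializationPairs k).op ⋙ X) hc
      obtain ⟨i, t, ht⟩ := Types.jointly_surjective_of_isColimit h₁ s.1
      replace ht : X.map ((constructibleSpec k).map (c.ι.app i).unop).op t = s.1 := ht
      obtain ⟨j, f, hf⟩ := (Types.FilteredColimit.isColimit_eq_iff' h₂
        (X.map ((pairFst k).app (K.obj i).unop).op t)
        (X.map ((pairSnd k).app (K.obj i).unop).op t)).1 (by
          change X.map ((specializationPairs k).map (c.ι.app i).unop).op _ =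
            X.map ((specializationPairs k).map (c.ι.app i).unop).op _
          rw [map_op_map_op, map_op_map_op, NatTrans.naturality, NatTrans.naturality,
            ← map_op_map_op, ← map_op_map_op, ht]
          exact s.2)
      refine ⟨j, ⟨X.map ((constructibleSpec k).map (K.map f).unop).op t, ?_⟩, Subtype.ext ?_⟩
      · rw [map_op_map_op, map_op_map_op, ← NatTrans.naturality, ← NatTrans.naturality,
          ← map_op_map_op, ← map_op_map_op]
        exact hf
      · change s.1 = X.map ((constructibleSpec k).map (c.ι.app j).unop).op
          (X.map ((constructibleSpec k).map (K.map f).unop).op t)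
        rw [map_op_map_op, ← Functor.map_comp, ← unop_comp, c.w, ht]
    · intro i s t h
      obtain ⟨j, f, hf⟩ := (Types.FilteredColimit.isColimit_eq_iff'
        (isColimitOfPreserves ((constructibleSpec k).op ⋙ X) hc) s.1 t.1).1
        (congrArg Subtype.val h)
      exact ⟨j, f, Subtype.ext hf⟩

lemma isAccessible_comparableSections [Functor.IsAccessible.{u} X] :
    Functor.IsAccessible.{u} ((comparableSections k).obj X) := by
  obtain ⟨κ, _, _⟩ := Functor.IsAccessible.exists_cardinal (F := X)
  have := isCardinalAccessible_comparableSections (k := k) (X := X) κ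
  exact Functor.isAccessible_of_isCardinalAccessible _ κ

instance {J : Type*} [Category* J] : PreservesLimitsOfShape J (comparableSections k) := by
  refine preservesLimitsOfShape_of_evaluation _ _ fun A => ⟨fun {K} => ⟨fun {c} hc => ?_⟩⟩
  have H (S : Profinite.{u}ᵒᵖ) := (Types.isLimit_iff _).1
    ⟨isLimitOfPreserves ((evaluation _ (Type u)).obj S) hc⟩
  rw [Types.isLimit_iff]
  intro s hs
  obtain ⟨x, hx, hx'⟩ := H (op ((constructibleSpec k).obj A.unop)) (fun j => (s j).1)
    fun {i j} f => congrArg Subtype.val (hs f)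
  refine ⟨⟨x, ?_⟩, fun j => Subtype.ext (hx j), fun y hy => Subtype.ext (hx' _ fun j =>
    congrArg Subtype.val (hy j))⟩
  refine (H (op ((specializationPairs k).obj A.unop))
    (fun j => (K.obj j).map ((pairFst k).app A.unop).op (s j).1) ?_).unique ?_ ?_
  · intro i j f
    exact (NatTrans.naturality_apply (K.map f) _ _).trans
      (congrArg _ (congrArg Subtype.val (hs f)))
  · intro j
    exact (NatTrans.naturality_apply (c.π.app j) _ _).trans (congrArg _ (hx j))
  · intro j
    exact (NatTrans.naturality_apply (c.π.app j) _ _).trans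
      ((congrArg _ (hx j)).trans (s j).2.symm)

end ComparableSections

/-! ### Locally bijective morphisms of presheaves -/

section LocallyBijective

/-- This is the universal property of sheafification for a locally bijective `α`, obtained by gluing
directly, so that no smallness of the site is needed. -/
lemma bijective_precomp_of_locally_bijective {C : Type*} [Category* C] (J : GrothendieckTopology C)
    {P F Y : Cᵒᵖ ⥤ Type u} (α : P ⟶ F) (hinj : ∀ U, Function.Injective (α.app U))
    (hsurj : ∀ (U : C) (s : F.obj (op U)), ∃ S ∈ J U, ∀ ⦃V : C⦄ (f : V ⟶ U), S f →
      ∃ r, α.app (op V) r = F.map f.op s)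
    (hY : Presieve.IsSheaf J Y) : Function.Bijective fun g : F ⟶ Y => α ≫ g := by
  choose S hS r hr using hsurj
  constructor
  · intro g₁ g₂ h
    ext U s
    refine (hY _ (hS U.unop s)).isSeparatedFor.ext fun V f hf => ?_
    have h' (x : P.obj (op V)) : g₁.app _ (α.app _ x) = g₂.app _ (α.app _ x) :=
      ConcreteCategory.congr_hom (NatTrans.congr_app h (op V)) x
    change Y.map f.op (g₁.app (op U.unop) s) = Y.map f.op (g₂.app (op U.unop) s)
    rw [← NatTrans.naturality_apply, ← NatTrans.naturality_apply, ← hr U.unop s f hf]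
    exact h' _
  · intro β
    -- The glued value is characterized by all local preimages of `s`, not only those on the chosen
    -- cover; naturality then follows from uniqueness.
    have hext (U : C) (s : F.obj (op U)) : ∃ t : Y.obj (op U),
        ∀ (V : C) (f : V ⟶ U) (x : P.obj (op V)), α.app _ x = F.map f.op s →
          Y.map f.op t = β.app _ x := by
      let y : Presieve.FamilyOfElements Y (S U s).arrows := fun V f hf => β.app _ (r U s f hf)
      have hy : y.Compatible := by
        intro V₁ V₂ W g₁ g₂ f₁ f₂ h₁ h₂ hW
        change Y.map g₁.op (β.app _ _) = Y.map g₂.op (β.app _ _)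
        rw [← NatTrans.naturality_apply, ← NatTrans.naturality_apply]
        refine congrArg _ (hinj _ ?_)
        rw [NatTrans.naturality_apply, NatTrans.naturality_apply, hr, hr, map_op_map_op,
          map_op_map_op, hW]
      obtain ⟨t, ht, -⟩ := hY _ (hS U s) y hy
      refine ⟨t, fun V f x hx => ?_⟩
      refine (hY _ (J.pullback_stable f (hS U s))).isSeparatedFor.ext fun W g hg => ?_
      replace hg : S U s (g ≫ f) := hg
      rw [map_op_map_op, ht _ hg, ← NatTrans.naturality_apply]
      refine congrArg _ (hinj _ ?_)
      rw [hr, NatTrans.naturality_apply, hx, map_op_map_op]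
    choose t ht using hext
    have huniq (U : C) (s : F.obj (op U)) (t' : Y.obj (op U))
        (h : ∀ (V : C) (f : V ⟶ U) (x : P.obj (op V)), α.app _ x = F.map f.op s →
          Y.map f.op t' = β.app _ x) : t' = t U s := by
      refine (hY _ (hS U s)).isSeparatedFor.ext fun V f hf => ?_
      rw [h V f _ (hr U s f hf), ht U s V f _ (hr U s f hf)]
    refine ⟨{ app U := ↾(t U.unop), naturality U V f := ?_ }, ?_⟩
    · ext s
      refine (huniq V.unop (F.map f s) (Y.map f (t U.unop s)) fun W g x hx => ?_).symm
      rw [← Quiver.Hom.op_unop f, map_op_map_op] at hx ⊢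
      exact ht _ _ _ _ _ hx
    · ext U x
      have h1 := ht U.unop (α.app U x) U.unop (𝟙 _) x (by simp)
      have h2 : Y.map (𝟙 U.unop).op (t U.unop (α.app U x)) = t U.unop (α.app U x) := by simp
      exact h2.symm.trans h1

end LocallyBijective


/-! ### Continuity of the functor of continuous functions -/

section Continuity

variable (k : Type u) [Field k]

lemma flat_ringHom_locallyConstant {k S B : Type*} [Field k] [TopologicalSpace S] [CommRing B]
    (f : LocallyConstant S k →+* B) : f.Flat := by
  let := f.toAlgebra
  exact (inferInstance : Module.Flat (LocallyConstant S k) B)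

/-- Flatness is automatic over `C(S, k)`, and all its primes are evaluations, so joint surjectivity
on points gives it on spectra. -/
lemma coverPreserving_continuousFunctions :
    CoverPreserving (coherentTopology Profinite.{u}) (fpqcTopology k) (continuousFunctions k) where
  cover_preserve {S R} hR := by
    obtain ⟨α, _, Y, π, hπ, hR⟩ :=
      (coherentTopology.mem_sieves_iff_hasEffectiveEpiFamily R).1 hR
    have hsurj : ∀ s : S, ∃ (a : α) (y : Y a), π a y = s :=
      ((Profinite.effectiveEpiFamily_tfae Y π).out 0 2).1 hπ
    obtain ⟨n, ⟨e⟩⟩ := Finite.exists_equiv_fin α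
    have hmem : Presieve.ofArrows (fun i => (continuousFunctions k).obj (Y (e.symm i)))
        (fun i => (continuousFunctions k).map (π (e.symm i))) ∈
          fpqcPrecoverage k ((continuousFunctions k).obj S) := by
      refine ⟨n, fun i => CommAlgCat.of k (LocallyConstant (Y (e.symm i)) k),
        fun i => ((continuousFunctions k).map (π (e.symm i))).unop, fun i => ?_, fun p => ?_, rfl⟩
      · exact flat_ringHom_locallyConstant (S := S) _
      · obtain ⟨s, rfl⟩ := exists_eq_evalPrime (S := S) p
        obtain ⟨a, y, rfl⟩ := hsurj s
        obtain ⟨i, rfl⟩ := e.symm.surjective a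
        exact ⟨i, evalPrime k y, rfl⟩
    refine (fpqcTopology k).superset_covering ?_ (Precoverage.generate_mem_toGrothendieck hmem)
    rw [Sieve.generate_le_iff]
    rintro _ _ ⟨i⟩
    exact Sieve.image_mem_functorPushforward _ _ (hR _)

instance : PreservesFiniteLimits (continuousFunctions k) where
  preservesFiniteLimits _ _ _ := (componentsAdjunction k).rightAdjoint_preservesLimits.1

instance : (continuousFunctions k).IsContinuous (coherentTopology Profinite.{u})
    (fpqcTopology k) := by
  have := flat_of_preservesFiniteLimits (continuousFunctions k)
  exact Functor.isContinuous_iff_coverPreserving.2 (coverPreserving_continuousFunctions k)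

end Continuity

/-! ### Stone duality -/

section StoneDuality

variable (k : Type u) [Field k]

/-- The counit corresponds to the identity of `C(S, k)`, so `componentsHom_mem_iff` describes `p` as
the functions vanishing at the image of its component. -/
lemma counit_app_apply (S : Profinite.{u}) (p : PrimeSpectrum (LocallyConstant S k)) :
    p = evalPrime k ((componentsAdjunction k).counit.app S (toSpecComponents p)) := by
  let h := (componentsAdjunction k).counit.app S
  have hh : componentsHomEquiv k ((continuousFunctions k).obj S) S h = 𝟙 _ :=
    Equiv.apply_symm_apply _ _
  have hh' : componentsHom (k := k) h.hom.hom = AlgHom.id k (LocallyConstant S k) :=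
    congrArg (fun f => f.unop.hom) hh
  ext f
  have := componentsHom_mem_iff h.hom.hom f p
  rw [hh'] at this
  exact this

lemma evalPrime_injective {S : Type*} [TopologicalSpace S] [TotallySeparatedSpace S] :
    Function.Injective (evalPrime k (S := S)) := by
  intro s t hst
  by_contra hne
  obtain ⟨U, hU, hs, ht⟩ := exists_isClopen_of_totally_separated hne
  have h1 : LocallyConstant.charFn k hU ∈ (evalPrime k t).asIdeal :=
    mem_evalPrime.2 ((LocallyConstant.charFn_eq_zero k t hU).2 ht)
  rw [← hst, mem_evalPrime] at h1
  exact (LocallyConstant.charFn_eq_zero k s hU).1 h1 hs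

instance : IsIso (componentsAdjunction k).counit := by
  refine @NatIso.isIso_of_isIso_app _ _ _ _ _ _ _ fun S => CompHausLike.isIso_of_bijective _ ⟨?_, ?_⟩
  · intro x y hxy
    obtain ⟨p, rfl⟩ := toSpecComponents_surjective x
    obtain ⟨q, rfl⟩ := toSpecComponents_surjective y
    have h1 := counit_app_apply k S p
    rw [hxy] at h1
    rw [h1, ← counit_app_apply k S q]
  · intro s
    exact ⟨toSpecComponents (evalPrime k s), (evalPrime_injective k (counit_app_apply k S _)).symm⟩

lemma isIso_constructibleSpecToComponents (S : Profinite.{u}) :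
    IsIso ((constructibleSpecToComponents k).app ((continuousFunctions k).obj S)) := by
  refine CompHausLike.isIso_of_bijective _ ⟨?_, ?_⟩
  · rintro ⟨p⟩ ⟨q⟩ hpq
    have h1 := counit_app_apply k S p
    have hpq' : toSpecComponents p = toSpecComponents q := hpq
    rw [hpq', ← counit_app_apply k S q] at h1
    rw [h1]
  · intro y
    obtain ⟨p, rfl⟩ := toSpecComponents_surjective y
    exact ⟨⟨p⟩, rfl⟩

/-- The algebra of continuous functions as a fully faithful functor. -/
noncomputable def continuousFunctionsFullyFaithful : (continuousFunctions k).FullyFaithful :=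
  (componentsAdjunction k).fullyFaithfulROfIsIsoCounit

/-- A profinite set is the cofiltered limit of its finite discrete quotients, and a right adjoint
preserves this limit. -/
lemma isStone_continuousFunctions (S : Profinite.{u}) :
    isStone k ((continuousFunctions k).obj S).unop := by
  have hc := isColimitCoconeLeftOpOfCone _
    (isLimitOfPreserves (continuousFunctions k) S.asLimit)
  refine ObjectProperty.colimitsClosure.of_colimitPresentation
    (a := ⟨Cat.of (DiscreteQuotient S)ᵒᵖ, inferInstanceAs (IsFiltered (DiscreteQuotient S)ᵒᵖ)⟩)
    ⟨_, _, hc⟩ fun Q => ObjectProperty.le_colimitsClosure _ _ _ 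
      ⟨S.diagram.obj Q.unop, inferInstanceAs (Finite Q.unop), ⟨?_⟩⟩
  have : DiscreteTopology (S.diagram.obj Q.unop) := ⟨rfl⟩
  exact CommAlgCat.isoMk (AlgEquiv.ofBijective (LocallyConstant.coeFnAlgHom k)
    ⟨LocallyConstant.coe_injective, fun f =>
      ⟨⟨f, IsLocallyConstant.of_discrete f⟩, rfl⟩⟩)

variable {k}

lemma mem_range_componentsHom_id {A : Type u} [CommRing A] [Algebra k A] {S : Type*}
    [TopologicalSpace S] [CompactSpace S] [T2Space S] [TotallyDisconnectedSpace S]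
    (ψ : LocallyConstant S k →ₐ[k] A) (f : LocallyConstant S k) :
    ψ f ∈ Set.range (componentsHom (k := k) (ContinuousMap.id (SpecComponents A))) := by
  obtain ⟨h, rfl⟩ := componentsHom_surjective ψ
  exact ⟨f.comap h, rfl⟩

lemma componentsHom_id_injective (A : Type u) [CommRing A] [Algebra k A] :
    Function.Injective (componentsHom (k := k) (ContinuousMap.id (SpecComponents A))) := by
  rw [injective_iff_map_eq_zero]
  intro f hf
  ext x
  obtain ⟨p, rfl⟩ := toSpecComponents_surjective x
  refine (componentsHom_mem_iff (ContinuousMap.id (SpecComponents A)) f p).1 ?_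
  rw [hf]
  exact p.asIdeal.zero_mem

/-- An element of a filtered colimit comes from some stage, where it lies in the image of an algebra
`C(S, k)`; by `mem_range_componentsHom_id` every such image in the colimit lies in that of `C(π₀ A,
k)`. -/
lemma componentsHom_id_surjective_of_isStone {A : CommAlgCat.{u} k} (hA : isStone k A) :
    Function.Surjective (componentsHom (k := k) (ContinuousMap.id (SpecComponents A))) := by
  induction hA with
  | of_mem A h =>
    intro a
    obtain ⟨S, _, ⟨e⟩⟩ := h
    let : TopologicalSpace S := ⊥
    have : DiscreteTopology S := ⟨rfl⟩
    have := mem_range_componentsHom_id (e.inv.hom.comp (LocallyConstant.coeFnAlgHom k))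
      (⟨e.hom.hom a, IsLocallyConstant.of_discrete _⟩ : LocallyConstant S k)
    exact (e.hom_inv_id_apply a) ▸ this
  | of_isoClosure e h ih =>
    intro a
    obtain ⟨f, hf⟩ := ih (e.inv.hom a)
    have := mem_range_componentsHom_id (e.hom.hom.comp (componentsHom (ContinuousMap.id _))) f
    rw [AlgHom.comp_apply, hf] at this
    exact (e.inv_hom_id_apply a) ▸ this
  | @of_colimitPresentation X a p h ih =>
    intro x
    have := a.2
    obtain ⟨j, y, rfl⟩ := Types.jointly_surjective_of_isColimit
      (isColimitOfPreserves (forget (CommAlgCat.{u} k)) p.isColimit) x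
    obtain ⟨f, rfl⟩ := ih j y
    exact mem_range_componentsHom_id ((p.ι.app j).hom.comp (componentsHom (ContinuousMap.id _))) f

variable (k)

/-- The functor of continuous functions with values in Stone algebras. -/
def stoneFunctor : Profinite.{u} ⥤ (StoneAlg k)ᵒᵖ :=
  ((isStone k).lift (continuousFunctions k).leftOp
    (fun S => isStone_continuousFunctions k S.unop)).rightOp

/-- The functor `stoneFunctor` is fully faithful. -/
noncomputable def stoneFunctorFullyFaithful : (stoneFunctor k).FullyFaithful :=
  Functor.FullyFaithful.ofCompFaithful (G := (isStone k).ι.op) (continuousFunctionsFullyFaithful k)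

instance : (stoneFunctor k).IsEquivalence where
  faithful := (stoneFunctorFullyFaithful k).faithful
  full := (stoneFunctorFullyFaithful k).full
  essSurj := ⟨fun A => by
    have e := AlgEquiv.ofBijective (componentsHom (k := k)
      (ContinuousMap.id (SpecComponents A.unop.obj)))
      ⟨componentsHom_id_injective _, componentsHom_id_surjective_of_isStone A.unop.property⟩
    refine ⟨(specComponents k).obj (op A.unop.obj), ⟨?_⟩⟩
    exact ((isStone k).fullyFaithfulι.op).preimageIso (CommAlgCat.isoMk e).symm.op⟩

end StoneDuality


/-! ### Accessible sheaves -/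

section AccSheaf

variable {C : Type (u + 1)} [Category.{u} C] (J : GrothendieckTopology C)

/-- The functor from accessible sheaves to presheaves is fully faithful. -/
def fullyFaithfulToPresheaf : (AccSheaf.toPresheaf J).FullyFaithful :=
  (ObjectProperty.fullyFaithfulι _).comp (fullyFaithfulSheafToPresheaf _ _)

instance : (AccSheaf.toPresheaf J).Full := (fullyFaithfulToPresheaf J).full

instance : (AccSheaf.toPresheaf J).Faithful := (fullyFaithfulToPresheaf J).faithful

/-- Finitely many regular cardinals have a largest one, which serves for all terms of the diagram
and hence for the finite limit. -/
lemma isAccessible_of_isLimit {D : Type*} [Category* D] {K : Type} [SmallCategory K] [FinCategory K]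
    {F : K ⥤ D ⥤ Type u} {c : Cone F} (hc : IsLimit c)
    (hF : ∀ j, Functor.IsAccessible.{u} (F.obj j)) : Functor.IsAccessible.{u} c.pt := by
  choose κ hκ hF using fun j => (hF j).exists_cardinal
  obtain ⟨μ, hμ, hle⟩ : ∃ (μ : Cardinal.{u}) (_ : Fact μ.IsRegular), ∀ j, κ j ≤ μ := by
    cases isEmpty_or_nonempty K
    · exact ⟨_, Cardinal.fact_isRegular_aleph0, fun j => isEmptyElim j⟩
    · obtain ⟨j, hj⟩ := Finite.exists_max κ
      exact ⟨κ j, hκ j, hj⟩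
  have (j : K) : (F.obj j).IsCardinalAccessible μ := Functor.isCardinalAccessible_of_le _ (hle j)
  have := Functor.isCardinalAccessible_of_isLimit c hc μ
    (hasCardinalLT_of_finite _ _ (Cardinal.IsRegular.aleph0_le Fact.out))
  exact Functor.isAccessible_of_isCardinalAccessible _ μ

instance {K : Type} [SmallCategory K] [FinCategory K] :
    ObjectProperty.IsClosedUnderLimitsOfShape
      (fun F : Sheaf J (Type u) => Functor.IsAccessible.{u} F.obj) K where
  limitsOfShape_le _ := fun ⟨p⟩ =>
    isAccessible_of_isLimit (isLimitOfPreserves (sheafToPresheaf J (Type u)) p.isLimit)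
      p.prop_diag_obj

end AccSheaf

/-! ### The adjunction between condensed sets and fpqc sheaves -/

section Adjunction

variable (k : Type u) [Field k]

/-- The fpqc sheaf attached to a condensed set. -/
noncomputable def fStar : Cond.{u} ⥤ FpqcSheaf k :=
  ObjectProperty.lift _
    (ObjectProperty.lift _ (AccSheaf.toPresheaf _ ⋙ comparableSections k) fun X =>
      (isSheaf_iff_isSheaf_of_type _ _).2
        (isSheaf_comparableSections ((isSheaf_iff_isSheaf_of_type _ _).1 X.obj.property)))
    fun X => have := X.property; isAccessible_comparableSections (X := X.obj.obj)

/-- The restriction of an fpqc sheaf along the functor of continuous functions. -/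
def fLowerStar : FpqcSheaf k ⥤ Cond.{u} :=
  ObjectProperty.lift _
    (ObjectProperty.lift _ (AccSheaf.toPresheaf _ ⋙
      (Functor.whiskeringLeft _ _ (Type u)).obj (continuousFunctions k).op) fun Y =>
        (continuousFunctions k).op_comp_isSheaf _ (fpqcTopology k) Y.obj)
    fun Y => by
      have := Y.property
      obtain ⟨κ, _, _⟩ := this.exists_cardinal
      have : ((continuousFunctions k).op ⋙ Y.obj.obj).IsCardinalAccessible κ :=
        ⟨fun J _ _ => by
          have := preservesColimitsOfShape_op J (continuousFunctions k)
          have := Y.obj.obj.preservesColimitsOfShape_of_isCardinalAccessible κ J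
          infer_instance⟩
      exact Functor.isAccessible_of_isCardinalAccessible
        ((continuousFunctions k).op ⋙ Y.obj.obj) κ

lemma fStar_toPresheaf :
    fStar k ⋙ AccSheaf.toPresheaf _ = AccSheaf.toPresheaf _ ⋙ comparableSections k := rfl

instance : PreservesFiniteLimits (fStar k) where
  preservesFiniteLimits K _ _ := by
    have : PreservesLimitsOfShape K (fStar k ⋙ AccSheaf.toPresheaf _) := by
      rw [fStar_toPresheaf]
      infer_instance
    exact preservesLimitsOfShape_of_reflects_of_preserves (fStar k) (AccSheaf.toPresheaf _)

/-- Morphisms out of the pullback of a condensed set. -/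
noncomputable def fStarHomEquiv (X : Cond.{u}) (Y : FpqcSheaf k) :
    ((fStar k).obj X ⟶ Y) ≃ (X ⟶ (fLowerStar k).obj Y) :=
  -- Maps out of `f^*X` are maps out of the presheaf `X(π₀ -)` by local bijectivity, and these are
  -- transposed by the adjunction between `π₀` and `C(-, k)`.
  (fullyFaithfulToPresheaf (fpqcTopology k)).homEquiv.trans <|
    (Equiv.ofBijective
      (fun g : (comparableSections k).obj X.obj.obj ⟶ Y.obj.obj =>
        (componentSections k).app X.obj.obj ≫ g)
      (bijective_precomp_of_locally_bijective (fpqcTopology k) _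
        (componentSections_injective
          ((isSheaf_iff_isSheaf_of_type _ _).1 X.obj.property))
        componentSections_locally_surjective
        ((isSheaf_iff_isSheaf_of_type _ _).1 Y.obj.property))).trans <|
    (((componentsAdjunction k).op.whiskerLeft (Type u)).homEquiv X.obj.obj Y.obj.obj).trans
      ((fullyFaithfulToPresheaf (coherentTopology Profinite.{u})).homEquiv
        (X := X) (Y := (fLowerStar k).obj Y)).symm

variable {k} in
lemma toPresheaf_map_fStarHomEquiv {X : Cond.{u}} {Y : FpqcSheaf k} (g : (fStar k).obj X ⟶ Y) :
    (AccSheaf.toPresheaf _).map (fStarHomEquiv k X Y g) =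
      ((componentsAdjunction k).op.whiskerLeft (Type u)).homEquiv X.obj.obj Y.obj.obj
        ((componentSections k).app X.obj.obj ≫ (AccSheaf.toPresheaf _).map g) :=
  rfl

/-- The adjunction between condensed sets and fpqc sheaves. -/
noncomputable def fStarAdjunction : fStar k ⊣ fLowerStar k :=
  Adjunction.mkOfHomEquiv
    { homEquiv := fStarHomEquiv k
      homEquiv_naturality_left_symm := fun {X X' Y} f g => by
        obtain ⟨h, rfl⟩ := (fStarHomEquiv k X' Y).surjective g
        rw [Equiv.symm_apply_eq, Equiv.symm_apply_apply]
        apply (AccSheaf.toPresheaf _).map_injective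
        rw [toPresheaf_map_fStarHomEquiv, Functor.map_comp, Functor.map_comp,
          toPresheaf_map_fStarHomEquiv]
        refine (Adjunction.homEquiv_naturality_left _ _ _).symm.trans (congrArg _ ?_)
        exact (componentSections k).naturality_assoc ((AccSheaf.toPresheaf _).map f) _
      homEquiv_naturality_right := fun {X Y Y'} f g => by
        apply (AccSheaf.toPresheaf _).map_injective
        rw [toPresheaf_map_fStarHomEquiv, Functor.map_comp, Functor.map_comp,
          toPresheaf_map_fStarHomEquiv]
        exact (congrArg _ (Category.assoc _ _ _).symm).trans
          (Adjunction.homEquiv_naturality_right _ _ _) }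

lemma unit_fStarAdjunction_app_apply (X : Cond.{u}) (S : Profinite.{u}) (s : X.obj.obj.obj (op S)) :
    (((AccSheaf.toPresheaf _).map ((fStarAdjunction k).unit.app X)).app (op S) s).1 =
      X.obj.obj.map ((constructibleSpecToComponents k).app ((continuousFunctions k).obj S) ≫
        (componentsAdjunction k).counit.app S).op s := by
  have h : (fStarAdjunction k).unit.app X = fStarHomEquiv k X _ (𝟙 _) :=
    (Adjunction.homEquiv_id (fStarAdjunction k) X).symm
  have h' := (congrArg (AccSheaf.toPresheaf _).map h).trans (toPresheaf_map_fStarHomEquiv _)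
  refine (congrArg Subtype.val (ConcreteCategory.congr_hom (NatTrans.congr_app h' (op S)) s)).trans ?_
  rw [← map_op_map_op]
  rfl

instance : IsIso (fStarAdjunction k).unit := by
  refine @NatIso.isIso_of_isIso_app _ _ _ _ _ _ _ fun X => ?_
  suffices IsIso ((AccSheaf.toPresheaf _).map ((fStarAdjunction k).unit.app X)) from
    isIso_of_fully_faithful (AccSheaf.toPresheaf _) _
  refine @NatIso.isIso_of_isIso_app _ _ _ _ _ _ _ fun S => (isIso_iff_bijective _).2 ?_
  have := isIso_constructibleSpecToComponents k S.unop
  have hbij := (isIso_iff_bijective (X.obj.obj.map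
    ((constructibleSpecToComponents k).app ((continuousFunctions k).obj S.unop) ≫
      (componentsAdjunction k).counit.app S.unop).op)).1 inferInstance
  have key := unit_fStarAdjunction_app_apply k X S.unop
  -- Restriction from `S` is already bijective onto all sections over the constructible spectrum, so
  -- comparability imposes no condition here.
  refine ⟨fun s t h => hbij.1 ?_, fun t => ?_⟩
  · rw [← key, ← key]
    exact congrArg Subtype.val h
  · obtain ⟨s, hs⟩ := hbij.2 t.1
    exact ⟨s, Subtype.ext ((key s).trans hs)⟩

end Adjunction

end Petra

theorem mainTheorem1 (k : Type u) [Field k] :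
    ∃ (stoneDuality : Profinite.{u} ≌ (StoneAlg k)ᵒᵖ)
      (fStar : Cond.{u} ⥤ FpqcSheaf k) (fLowerStar : FpqcSheaf k ⥤ Cond.{u})
      (_ : fStar ⊣ fLowerStar),
      Nonempty (stoneDuality.functor ⋙ (isStone k).ι.op ≅ continuousFunctions k) ∧
      Nonempty (fLowerStar ⋙ AccSheaf.toPresheaf (coherentTopology Profinite.{u}) ≅
        AccSheaf.toPresheaf (fpqcTopology k) ⋙
          (Functor.whiskeringLeft _ _ (Type u)).obj
            (continuousFunctions k).op) ∧
      fStar.Full ∧ fStar.Faithful ∧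
      PreservesColimitsOfSize.{w, w'} fStar ∧
      PreservesFiniteLimits fStar :=
  ⟨(stoneFunctor k).asEquivalence, fStar k, fLowerStar k, fStarAdjunction k, ⟨Iso.refl _⟩,
    ⟨Iso.refl _⟩, (fStarAdjunction k).fullyFaithfulLOfIsIsoUnit.full,
    (fStarAdjunction k).fullyFaithfulLOfIsIsoUnit.faithful,
    (fStarAdjunction k).leftAdjoint_preservesColimits, inferInstance⟩
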